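/- **Proposition 4.5.** A Banach analytic manifold is a connected Hausdorff space with a holomorphic atlas modelled on a complex Banach space, and $\mathrm{Hol}(A,X)$ denotes the set of holomorphic mappings from $A$ into $X$ with the compact-open topology. For a subset $S$ of a Banach analytic manifold $A$ let $S^u$ be the set of all $z\in\overline S$ such that, for every connected open neighbourhood $U$ of $z$, each holomorphic $f:U\to\mathbb C$ with $f|_{U\cap S}=0$ vanishes identically on $U$. For a sequence $\{f_k\}\subset \mathrm{Hol}(A,X)$ let $Z_{\{f_k\}}$ be the set of all $\lambda\in A$ such that $\{f_k(\lambda)\}$ converges in $X$. The manifold $X$ has the strong (resp. weak) Vitali property, SVP (resp. WVP), if for every Banach analytic manifold $A$ each sequence $\{f_k\}\subset \mathrm{Hol}(A,X)$ with $Z^u_{\{f_k\}}\neq\emptyset$ (resp. $Z_{\{f_k\}}\cap Z^u_{\{f_k\}}\ne\emptyset$) converges in $\mathrm{Hol}(A,X)$. A function $\varphi:X\to[-\infty,\infty)$ is plurisubharmonic if every point of $X$ has a neighbourhood biholomorphic to a ball $B$ of a Banach space in which $\varphi$, regarded as a function on $B$, is upper semicontinuous and is subharmonic (the constant $-\infty$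 being allowed) on the intersection of $B$ with each complex line. Let $X$ be a Banach analytic manifold, let $\varphi:X\to[-\infty,\infty)$ be upper semicontinuous, and let $$\Omega_\varphi(X)=\{(z,w)\in X\times\mathbb C:\ |w|<e^{-\varphi(z)}\}$$ be the Hartogs domain, where $e^{-\varphi(z)}=\infty$ if $\varphi(z)=-\infty$. Then $\Omega_\varphi(X)$ has SVP (resp. WVP) if and only if $\varphi$ is a real-valued (that is, nowhere equal to $-\infty$), continuous and plurisubharmonic function on $X$ and $X$ has SVP (resp. WVP). -/

import Mathlib

open Set Filter Topology MeasureTheory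
open scoped Manifold ContDiff ENNReal

universe u v v' w

noncomputable section

/-! ### Holomorphic mappings and the Vitali properties

A Banach analytic manifold is a connected Hausdorff space with an analytic atlas modelled on a
complex Banach space.  A mapping between such manifolds is holomorphic when it is (Fréchet)
complex differentiable at every point. -/

/-- The space of holomorphic mappings, with the (subspace topology of the) compact-open
topology. -/
abbrev Hol {F : Type*} [NormedAddCommGroup F] [NormedSpace ℂ F]
    {H' : Type*} [TopologicalSpace H'] (J : ModelWithCorners ℂ F H')
    {E : Type*} [NormedAddCommGroup E] [NormedSpace ℂ E]
    {H : Type*} [TopologicalSpace H] (I : ModelWithCorners ℂ E H)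
    (A : Type*) [TopologicalSpace A] [ChartedSpace H' A]
    (X : Type*) [TopologicalSpace X] [ChartedSpace H X] :=
  {f : C(A, X) // MDifferentiable J I f}

/-- The set `S^u` of all points `z` in the closure of `S` such that, for every connected (open)
neighbourhood `U` of `z`, a holomorphic function on `U` which vanishes on `U ∩ S` vanishes
on `U`. -/
def uniquenessPoints (F : Type*) [NormedAddCommGroup F] [NormedSpace ℂ F]
    {A : Type*} [TopologicalSpace A] [ChartedSpace F A] (S : Set A) : Set A :=
  {z | z ∈ closure S ∧ ∀ U : Set A, IsOpen U → IsConnected U → z ∈ U →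
    ∀ f : A → ℂ, MDifferentiableOn 𝓘(ℂ, F) 𝓘(ℂ, ℂ) f U →
      (∀ x ∈ U ∩ S, f x = 0) → ∀ x ∈ U, f x = 0}

/-- The set of points at which a sequence of mappings converges. -/
def convergenceSet {A X : Type*} [TopologicalSpace X] (f : ℕ → A → X) : Set A :=
  {a | ∃ x : X, Tendsto (fun k => f k a) atTop (𝓝 x)}

/-- Convergence of a sequence in the space of holomorphic mappings (the limit is required to be
a holomorphic mapping with the same target). -/
def ConvergesInHol {F : Type*} [NormedAddCommGroup F] [NormedSpace ℂ F]
    {H' : Type*} [TopologicalSpace H'] {J : ModelWithCorners ℂ F H'}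
    {E : Type*} [NormedAddCommGroup E] [NormedSpace ℂ E]
    {H : Type*} [TopologicalSpace H] {I : ModelWithCorners ℂ E H}
    {A : Type*} [TopologicalSpace A] [ChartedSpace H' A]
    {X : Type*} [TopologicalSpace X] [ChartedSpace H X]
    (f : ℕ → Hol J I A X) : Prop :=
  ∃ g : Hol J I A X, Tendsto f atTop (𝓝 g)

/-- The strong Vitali property of a complex manifold `X` with model `I`.  The source `A` ranges
over all Banach analytic manifolds (in an arbitrary universe `w`). -/
def HasSVP {E : Type v} [NormedAddCommGroup E] [NormedSpace ℂ E]
    {H : Type v'} [TopologicalSpace H] (I : ModelWithCorners ℂ E H)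
    (X : Type u) [TopologicalSpace X] [ChartedSpace H X] : Prop :=
  ∀ (F : Type w) [NormedAddCommGroup F] [NormedSpace ℂ F] [CompleteSpace F]
    (A : Type w) [TopologicalSpace A] [ChartedSpace F A] [IsManifold 𝓘(ℂ, F) ω A]
    [T2Space A] [ConnectedSpace A] (f : ℕ → Hol 𝓘(ℂ, F) I A X),
    (uniquenessPoints F (convergenceSet fun k => ⇑(f k).1)).Nonempty →
      ConvergesInHol f

/-- The weak Vitali property of a complex manifold `X` with model `I`. -/
def HasWVP {E : Type v} [NormedAddCommGroup E] [NormedSpace ℂ E]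
    {H : Type v'} [TopologicalSpace H] (I : ModelWithCorners ℂ E H)
    (X : Type u) [TopologicalSpace X] [ChartedSpace H X] : Prop :=
  ∀ (F : Type w) [NormedAddCommGroup F] [NormedSpace ℂ F] [CompleteSpace F]
    (A : Type w) [TopologicalSpace A] [ChartedSpace F A] [IsManifold 𝓘(ℂ, F) ω A]
    [T2Space A] [ConnectedSpace A] (f : ℕ → Hol 𝓘(ℂ, F) I A X),
    (convergenceSet (fun k => ⇑(f k).1) ∩
      uniquenessPoints F (convergenceSet fun k => ⇑(f k).1)).Nonempty →
      ConvergesInHol f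

/-! ### Plurisubharmonic functions -/

/-- The mean value `(1/2π) ∫₀^{2π} v (c + r e^{iθ}) dθ` of an extended real-valued function, as
the integral of the positive part minus the integral of the negative part, over `2π`.  For an upper semicontinuous
`v < ∞` the former is finite, so the value lies in `[-∞, ∞)`. -/
def circleMean (v : ℂ → EReal) (c : ℂ) (r : ℝ) : EReal :=
  (((∫⁻ θ in Ioc (0 : ℝ) (2 * Real.pi), (v (circleMap c r θ)).toENNReal) : ℝ≥0∞) -
    ((∫⁻ θ in Ioc (0 : ℝ) (2 * Real.pi), (-v (circleMap c r θ)).toENNReal) : ℝ≥0∞) : EReal) /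
      ((2 * Real.pi : ℝ) : EReal)

/-- Subharmonic functions with values in `[-∞, ∞)` on a plane (open) set `D`; the constant `-∞`
is allowed. -/
def IsSubharmonicOn (v : ℂ → EReal) (D : Set ℂ) : Prop :=
  (∀ z ∈ D, v z ≠ ⊤) ∧ UpperSemicontinuousOn v D ∧
    ∀ (c : ℂ) (r : ℝ), 0 < r → Metric.closedBall c r ⊆ D → v c ≤ circleMean v c r

/-- Plurisubharmonic functions on an (open) subset `B` of a complex normed space: upper
semicontinuous with values in `[-∞, ∞)`, and subharmonic on the intersection of `B` with each
complex line. -/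
def IsPSHOn {E : Type*} [NormedAddCommGroup E] [NormedSpace ℂ E]
    (φ : E → EReal) (B : Set E) : Prop :=
  (∀ x ∈ B, φ x ≠ ⊤) ∧ UpperSemicontinuousOn φ B ∧
    ∀ a b : E, IsSubharmonicOn (fun t : ℂ => φ (a + t • b)) {t : ℂ | a + t • b ∈ B}

/-- Plurisubharmonic functions on a Banach analytic manifold: every point lies in the domain of
a holomorphic chart onto a ball in which the function is plurisubharmonic. -/
def IsPSH (E : Type*) [NormedAddCommGroup E] [NormedSpace ℂ E]
    {X : Type*} [TopologicalSpace X] [ChartedSpace E X] (φ : X → EReal) : Prop :=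
  ∀ a : X, ∃ e ∈ IsManifold.maximalAtlas 𝓘(ℂ, E) ω X, a ∈ e.source ∧
    ∃ (c : E) (r : ℝ), e.target = Metric.ball c r ∧
      IsPSHOn (fun y => φ (e.symm y)) (Metric.ball c r)

/-! ### Hartogs domains -/

theorem isOpen_hartogs {X : Type*} [TopologicalSpace X] {φ : X → EReal}
    (hφ : UpperSemicontinuous φ) :
    IsOpen {p : X × ℂ | ‖p.2‖ₑ < EReal.exp (-φ p.1)} := by
  rw [isOpen_iff_mem_nhds]
  rintro ⟨z, w⟩ h
  obtain ⟨c, hc₁, hc₂⟩ := exists_between (show ‖w‖ₑ < EReal.exp (-φ z) from h)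
  obtain ⟨d, rfl⟩ : ∃ d : EReal, EReal.exp d = c := ⟨ENNReal.log c, ENNReal.exp_log c⟩
  rw [EReal.exp_lt_exp_iff] at hc₂
  have h₁ : ∀ᶠ p : X × ℂ in 𝓝 (z, w), φ p.1 < -d :=
    (continuous_fst.continuousAt (x := (z, w))).eventually (hφ z (-d) (EReal.lt_neg_comm.1 hc₂))
  have h₂ : ∀ᶠ p : X × ℂ in 𝓝 (z, w), ‖p.2‖ₑ < EReal.exp d :=
    (continuous_snd.enorm.continuousAt (x := (z, w))).eventually (gt_mem_nhds hc₁)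
  filter_upwards [h₁, h₂] with p hp₁ hp₂
  exact hp₂.trans (EReal.exp_lt_exp_iff.2 (EReal.lt_neg_comm.1 hp₁))

/-- The Hartogs domain `{(z, w) ∈ X × ℂ : |w| < e^{-φ(z)}}`, where `e^{-φ(z)} = ∞` if
`φ(z) = -∞`.  It is an open subset of `X × ℂ` and inherits its manifold structure. -/
def hartogsDomain {X : Type*} [TopologicalSpace X] (φ : X → EReal)
    (hφ : UpperSemicontinuous φ) : TopologicalSpace.Opens (X × ℂ) :=
  ⟨{p : X × ℂ | ‖p.2‖ₑ < EReal.exp (-φ p.1)}, isOpen_hartogs hφ⟩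

end

/-! Necessity. The zero section `x ↦ (x, 0)` embeds the base holomorphically in the Hartogs domain
and the projection is a left inverse, so either Vitali property passes to the base. The conditions
on `φ` need only the weak property, tested on analytic discs through
`HasWVP.exists_tendsto_of_disc`: a sequence of discs that converges inside the domain on a set
containing one of its own accumulation points must converge inside the domain everywhere. Each
failure of a condition yields a forbidden sequence. A value `⊥` puts a whole complex line into the
domain, which carries polynomials that converge on such a set and blow up elsewhere
(`HasWVP.ne_bot`). A failure of lower semicontinuity gives vertical discs whose limit disc leaves
the domain (`HasWVP.lowerSemicontinuous`). A failure of the sub-mean value inequality gives graphs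
whose limit touches the boundary at an interior point of the disc (`HasWVP.le_circleAverage`).

Sufficiency. The first components converge by the property of the base. The second components are
then locally bounded by `e^{-φ}`, and a Vitali theorem for scalar functions
(`exists_tendsto_uncurry_of_locally_bounded`) makes them converge to some `w` with `‖w‖ ≤ e^{-φ ∘
g}`. This inequality is strict wherever the original sequence converges in the domain, and the
maximum principle for `log ‖w‖ + φ ∘ g` makes it strict everywhere (`norm_lt_exp_neg`), so the limit
maps into the domain.

Plurisubharmonicity is given only on complex lines in a chart, whereas `g` carries lines to curved
discs. `SubMeanOn.le_circleAverage_disc` bridges this gap for continuous functions, by reduction to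
polynomial discs and then to a finite-dimensional Hilbert space. -/

/-! ### Continuous convergence and the compact-open topology -/

section ContinuousConvergence

variable {A X ι : Type*} [TopologicalSpace A] [TopologicalSpace X]

/-- Continuous convergence implies convergence in the compact-open topology. -/
theorem ContinuousMap.tendsto_of_tendsto_uncurry {l : Filter ι} {f : ι → C(A, X)} {g : C(A, X)}
    (h : ∀ a, Tendsto (fun p : ι × A => f p.1 p.2) (l ×ˢ 𝓝 a) (𝓝 (g a))) :
    Tendsto f l (𝓝 g) := by
  rw [ContinuousMap.tendsto_nhds_compactOpen]
  intro K hK U hU hg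
  have key : ∀ᶠ p : ι × A in l ×ˢ 𝓝ˢ K, f p.1 p.2 ∈ U := by
    rw [hK.prod_nhdsSet_eq_biSup]
    simp only [eventually_iSup]
    exact fun a ha => h a (hU.mem_nhds (hg ha))
  obtain ⟨P, hP, Q, hQ, hPQ⟩ := eventually_prod_iff.1 key
  filter_upwards [hP] with k hk a ha
  exact hPQ hk (hQ.self_of_nhdsSet a ha)

/-- On a first countable space, convergence of a sequence in the compact-open topology implies
continuous convergence. -/
theorem ContinuousMap.tendsto_uncurry_of_tendsto [FirstCountableTopology A] {f : ℕ → C(A, X)}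
    {g : C(A, X)} (h : Tendsto f atTop (𝓝 g)) (a : A) :
    Tendsto (fun p : ℕ × A => f p.1 p.2) (atTop ×ˢ 𝓝 a) (𝓝 (g a)) := by
  rw [(nhds_basis_opens (g a)).tendsto_right_iff]
  rintro U ⟨haU, hU⟩
  by_contra hne
  obtain ⟨ns, hns, hbad⟩ := exists_seq_forall_of_frequently (not_eventually.1 hne)
  obtain ⟨hk, hx⟩ := tendsto_prod_iff'.1 hns
  have hxU : ∀ᶠ j in atTop, g (ns j).2 ∈ U :=
    hx (g.continuous.continuousAt (hU.mem_nhds haU))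
  obtain ⟨J, hJ⟩ := eventually_atTop.1 hxU
  -- The bad points together with their limit form a compact set; dropping the first `J` of them
  -- makes `g` map it into `U`.
  have hx' : Tendsto (fun j => (ns (j + J)).2) atTop (𝓝 a) := hx.comp (tendsto_add_atTop_nat J)
  have hK := hx'.isCompact_insert_range
  have hmaps : MapsTo g (insert a (range fun j => (ns (j + J)).2)) U := by
    rintro _ (rfl | ⟨j, rfl⟩)
    exacts [haU, hJ _ (Nat.le_add_left _ _)]
  have hev := ContinuousMap.tendsto_nhds_compactOpen.1 h _ hK U hU hmaps
  obtain ⟨j, hj⟩ := ((hk.comp (tendsto_add_atTop_nat J)).eventually hev).exists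
  exact hbad _ (hj (Or.inr ⟨j, rfl⟩))

end ContinuousConvergence

/-! ### Charts -/

/-- Banach manifolds need not be locally compact, so compact-open convergence is turned into
continuous convergence by means of sequences. -/
theorem ChartedSpace.firstCountableTopology (H M : Type*) [TopologicalSpace H]
    [FirstCountableTopology H] [TopologicalSpace M] [ChartedSpace H M] :
    FirstCountableTopology M := by
  refine ⟨fun x => ?_⟩
  rw [← (chartAt H x).symm_map_nhds_eq (mem_chart_source H x)]
  infer_instance

section Opens

variable {𝕜 : Type*} [NontriviallyNormedField 𝕜]
  {E : Type*} [NormedAddCommGroup E] [NormedSpace 𝕜 E] {H : Type*} [TopologicalSpace H]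
  {I : ModelWithCorners 𝕜 E H} {M : Type*} [TopologicalSpace M] [ChartedSpace H M]
  {E' : Type*} [NormedAddCommGroup E'] [NormedSpace 𝕜 E'] {H' : Type*} [TopologicalSpace H']
  {I' : ModelWithCorners 𝕜 E' H'} {M' : Type*} [TopologicalSpace M'] [ChartedSpace H' M']

theorem mdifferentiableWithinAt_subtypeVal_comp_iff (U : TopologicalSpace.Opens M') (f : M → U)
    (s : Set M) (x : M) :
    MDifferentiableWithinAt I I' (Subtype.val ∘ f) s x ↔ MDifferentiableWithinAt I I' f s x :=
  ChartedSpace.liftPropWithinAt_subtypeVal_comp_iff ..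

theorem mdifferentiable_subtypeVal_comp_iff (U : TopologicalSpace.Opens M') (f : M → U) :
    MDifferentiable I I' (Subtype.val ∘ f) ↔ MDifferentiable I I' f := by
  simp_rw [← mdifferentiableOn_univ]
  exact forall₂_congr fun x _ => mdifferentiableWithinAt_subtypeVal_comp_iff U f univ x

theorem mdifferentiable_subtypeVal (U : TopologicalSpace.Opens M) :
    MDifferentiable I I (Subtype.val : U → M) :=
  (mdifferentiable_subtypeVal_comp_iff U id).2 mdifferentiable_id

end Opens

/-! ### Membership in the Hartogs domain -/

theorem mem_hartogsDomain {X : Type*} [TopologicalSpace X] {φ : X → EReal}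
    {hφ : UpperSemicontinuous φ} {p : X × ℂ} :
    p ∈ hartogsDomain φ hφ ↔ ‖p.2‖ₑ < EReal.exp (-φ p.1) := Iff.rfl

theorem enorm_lt_exp_neg_coe {z : ℂ} {a : ℝ} :
    ‖z‖ₑ < EReal.exp (-(a : EReal)) ↔ ‖z‖ < Real.exp (-a) := by
  rw [← EReal.coe_neg, EReal.exp_coe, ← ofReal_norm,
    ENNReal.ofReal_lt_ofReal_iff (Real.exp_pos _)]

theorem mem_hartogsDomain_iff_of_eq_coe {X : Type*} [TopologicalSpace X] {φ : X → EReal}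
    {hφ : UpperSemicontinuous φ} {u : X → ℝ} (hu : ∀ x, φ x = u x) {p : X × ℂ} :
    p ∈ hartogsDomain φ hφ ↔ ‖p.2‖ < Real.exp (-u p.1) := by
  rw [mem_hartogsDomain, hu, enorm_lt_exp_neg_coe]

/-! ### Circle averages -/

theorem Differentiable.circleAverage_re {Q : ℂ → ℂ} (hQ : Differentiable ℂ Q) (c : ℂ) (r : ℝ) :
    Real.circleAverage (fun z => (Q z).re) c r = (Q c).re := by
  have h := (hQ.diffContOnCl (s := Metric.ball c |r|)).circleAverage
  have hi : CircleIntegrable Q c r := hQ.continuous.continuousOn.circleIntegrable'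
  have := Complex.reCLM.circleAverage_comp_comm hi
  rw [h] at this
  exact this

theorem circleAverage_le_re_of_le {f : ℂ → ℝ} {c : ℂ} {r : ℝ} (hr : 0 ≤ r)
    (hf : ContinuousOn f (Metric.sphere c r)) {Q : ℂ → ℂ} (hQ : Differentiable ℂ Q)
    (h : ∀ z ∈ Metric.sphere c r, f z ≤ (Q z).re) : Real.circleAverage f c r ≤ (Q c).re := by
  rw [← hQ.circleAverage_re c r]
  refine Real.circleAverage_mono (hf.circleIntegrable hr)
    (Complex.continuous_re.comp hQ.continuous).continuousOn.circleIntegrable' ?_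
  rwa [abs_of_nonneg hr]

theorem re_le_circleAverage_of_le {f : ℂ → ℝ} {c : ℂ} {r : ℝ} (hr : 0 ≤ r)
    (hf : ContinuousOn f (Metric.sphere c r)) {Q : ℂ → ℂ} (hQ : Differentiable ℂ Q)
    (h : ∀ z ∈ Metric.sphere c r, (Q z).re ≤ f z) : (Q c).re ≤ Real.circleAverage f c r := by
  rw [← hQ.circleAverage_re c r]
  refine Real.circleAverage_mono
    (Complex.continuous_re.comp hQ.continuous).continuousOn.circleIntegrable'
    (hf.circleIntegrable hr) ?_
  rwa [abs_of_nonneg hr]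

/-- For a continuous real function, `circleMean` is the usual circle average. -/
theorem circleMean_eq_circleAverage {v : ℂ → EReal} {u : ℂ → ℝ} {c : ℂ} {r : ℝ} (hr : 0 ≤ r)
    (hv : ∀ z ∈ Metric.sphere c r, v z = u z) (hu : ContinuousOn u (Metric.sphere c r)) :
    circleMean v c r = (Real.circleAverage u c r : ℝ) := by
  have hint : IntegrableOn (fun θ => u (circleMap c r θ)) (Ioc 0 (2 * Real.pi)) := by
    have := (hu.circleIntegrable hr)
    rwa [CircleIntegrable, intervalIntegrable_iff_integrableOn_Ioc_of_le Real.two_pi_pos.le] at this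
  have hm : ∀ θ, v (circleMap c r θ) = u (circleMap c r θ) :=
    fun θ => hv _ (circleMap_mem_sphere c hr θ)
  have hpos := hint.lintegral_lt_top
  have hneg := hint.neg.lintegral_lt_top
  simp only [Pi.neg_apply] at hneg
  rw [circleMean, Real.circleAverage_def, intervalIntegral.integral_of_le Real.two_pi_pos.le,
    integral_eq_lintegral_pos_part_sub_lintegral_neg_part hint]
  simp only [hm, ← EReal.coe_neg, EReal.real_coe_toENNReal]
  rw [smul_eq_mul, mul_comm _⁻¹, ← div_eq_mul_inv, EReal.coe_div, EReal.coe_sub,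
    EReal.coe_ennreal_toReal hpos.ne, EReal.coe_ennreal_toReal hneg.ne]

/-- A continuous real function on a circle is a uniform limit of real parts of entire functions. -/
theorem exists_differentiable_re_near {c : ℂ} {r : ℝ} (hr : 0 < r) {u : ℂ → ℝ}
    (hu : ContinuousOn u (Metric.sphere c r)) {ε : ℝ} (hε : 0 < ε) :
    ∃ h : ℂ → ℂ, Differentiable ℂ h ∧ ∀ z ∈ Metric.sphere c r, |u z - (h z).re| < ε := by
  have : Fact (0 < 2 * Real.pi) := ⟨Real.two_pi_pos⟩
  let κ : AddCircle (2 * Real.pi) → ℂ := fun θ => c + r * (AddCircle.toCircle θ : ℂ)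
  have hκc : Continuous κ := by
    have := AddCircle.continuous_toCircle (T := 2 * Real.pi)
    fun_prop
  have hκs : ∀ θ, κ θ ∈ Metric.sphere c r := fun θ => by
    simp [κ, abs_of_pos hr, Circle.norm_coe]
  let g : C(AddCircle (2 * Real.pi), ℂ) :=
    ⟨fun θ => (u (κ θ) : ℂ), Complex.continuous_ofReal.comp (hu.comp_continuous hκc hκs)⟩
  have hg : g ∈ closure (Submodule.span ℂ (range (@fourier (2 * Real.pi))) : Set _) := by
    rw [← Submodule.topologicalClosure_coe, span_fourier_closure_eq_top]
    trivial
  obtain ⟨p, hp, hgp⟩ := Metric.mem_closure_iff.1 hg ε hε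
  -- The coefficient `a` is carried along so that the induction passes through complex scalars. A
  -- negative frequency is conjugated into a positive one, which does not change the real part.
  have key : ∀ a : ℂ, ∃ h : ℂ → ℂ, Differentiable ℂ h ∧ ∀ θ, (a * p θ).re = (h (κ θ)).re := by
    clear hgp
    induction hp using Submodule.span_induction with
    | mem x hx =>
      obtain ⟨n, rfl⟩ := hx
      intro a
      have hinv : ∀ θ, (κ θ - c) / r = (AddCircle.toCircle θ : ℂ) := fun θ => by
        simp [κ, hr.ne']
      have hpow : ∀ (m : ℕ) θ, fourier (T := 2 * Real.pi) m θ = ((κ θ - c) / r) ^ m := fun m θ => by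
        rw [hinv, fourier_apply, AddCircle.toCircle_zsmul, zpow_natCast, Circle.coe_pow]
      obtain ⟨m, rfl | rfl⟩ := n.eq_nat_or_neg
      · exact ⟨fun z => a * ((z - c) / r) ^ m, by fun_prop, fun θ => by rw [hpow]⟩
      · refine ⟨fun z => starRingEnd ℂ a * ((z - c) / r) ^ m, by fun_prop, fun θ => ?_⟩
        rw [fourier_neg, ← Complex.conj_re, map_mul, Complex.conj_conj, hpow]
    | zero => exact fun a => ⟨0, differentiable_const 0, by simp⟩
    | add x y _ _ hx hy =>
      intro a
      obtain ⟨h₁, d₁, e₁⟩ := hx a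
      obtain ⟨h₂, d₂, e₂⟩ := hy a
      refine ⟨h₁ + h₂, d₁.add d₂, fun θ => ?_⟩
      simp only [ContinuousMap.add_apply, mul_add, Complex.add_re, e₁, e₂, Pi.add_apply]
    | smul b x _ hx =>
      intro a
      obtain ⟨h, d, e⟩ := hx (a * b)
      exact ⟨h, d, fun θ => by rw [← e, ContinuousMap.smul_apply, smul_eq_mul, mul_assoc]⟩
  obtain ⟨h, hd, he⟩ := key 1
  refine ⟨h, hd, fun z hz => ?_⟩
  obtain ⟨θ, rfl⟩ : ∃ θ, κ θ = z := by
    rw [mem_sphere_iff_norm] at hz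
    have h1 : ‖(z - c) / r‖ = 1 := by
      rw [norm_div, hz, Complex.norm_real, Real.norm_of_nonneg hr.le, div_self hr.ne']
    obtain ⟨θ, hθ⟩ := (AddCircle.homeomorphCircle (T := 2 * Real.pi)
      Real.two_pi_pos.ne').surjective ⟨(z - c) / r, by simpa [Submonoid.unitSphere] using h1⟩
    rw [AddCircle.homeomorphCircle_apply] at hθ
    have hr' : (r : ℂ) ≠ 0 := by exact_mod_cast hr.ne'
    refine ⟨θ, ?_⟩
    simp only [κ, hθ]
    field_simp
    ring
  rw [← he, one_mul]
  have := (ContinuousMap.norm_coe_le_norm (g - p) θ).trans_lt (by rwa [← dist_eq_norm])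
  calc |u (κ θ) - (p θ).re| = |((g - p) θ).re| := by simp [g]
    _ ≤ _ := Complex.abs_re_le_norm _
    _ < ε := this

/-- If a continuous function violates the sub-mean value property on a disc, then some harmonic
function dominates it on the circle, but not at the centre. -/
theorem exists_differentiable_re_gt_of_circleAverage_lt {c : ℂ} {r : ℝ} (hr : 0 < r) {u : ℂ → ℝ}
    (hu : ContinuousOn u (Metric.sphere c r)) (hlt : Real.circleAverage u c r < u c) :
    ∃ h : ℂ → ℂ, Differentiable ℂ h ∧ (h c).re < u c ∧
      ∃ ε > 0, ∀ t ∈ Metric.sphere c r, u t - (h t).re < -ε := by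
  -- An `ε`-approximation raised by `2 * ε` exceeds `u` by more than `ε` on the circle, while its
  -- value at the centre is at most the average plus `3 * ε`.
  obtain ⟨ε, hε, hε4⟩ : ∃ ε : ℝ, 0 < ε ∧ Real.circleAverage u c r + 4 * ε ≤ u c :=
    ⟨(u c - Real.circleAverage u c r) / 4, by linarith, by linarith⟩
  obtain ⟨h₀, hd₀, hn₀⟩ := exists_differentiable_re_near hr hu hε
  refine ⟨fun t => h₀ t + (2 * ε : ℝ), by fun_prop, ?_, ε, hε, fun t ht => ?_⟩
  · have := re_le_circleAverage_of_le hr.le hu (Q := fun t => h₀ t - (ε : ℝ)) (by fun_prop)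
      fun t ht => by
        have := abs_lt.1 (hn₀ t ht)
        simp only [Complex.sub_re, Complex.ofReal_re]
        linarith
    simp only [Complex.sub_re, Complex.ofReal_re, Complex.add_re] at this ⊢
    linarith
  · have := abs_lt.1 (hn₀ t ht)
    simp only [Complex.add_re, Complex.ofReal_re]
    linarith

/-! ### Continuous plurisubharmonic functions along analytic discs -/

/-- The sub-mean value property of `ψ` on all closed discs contained in `W` and in a complex
line. -/
def SubMeanOn {H : Type*} [AddCommGroup H] [Module ℂ H] (ψ : H → ℝ) (W : Set H) : Prop :=
  ∀ (a b : H) (r : ℝ), 0 < r → (∀ t ∈ Metric.closedBall (0 : ℂ) r, a + t • b ∈ W) →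
    ψ a ≤ Real.circleAverage (fun t : ℂ => ψ (a + t • b)) 0 r

theorem eventually_add_mem_of_isCompact {T H : Type*} [TopologicalSpace T]
    [NormedAddCommGroup H] {γ : T → H} {K : Set T} (hK : IsCompact K) (hγ : Continuous γ)
    {W : Set H} (hW : IsOpen W) (h : ∀ t ∈ K, γ t ∈ W) :
    ∀ᶠ y in 𝓝 (0 : H), ∀ t ∈ K, γ t + y ∈ W := by
  refine hK.eventually_forall_of_forall_eventually fun t ht => ?_
  have : Continuous fun z : H × T => γ z.2 + z.1 := by fun_prop
  exact this.continuousAt.eventually_mem (hW.mem_nhds (by simpa using h t ht))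

/-- A continuous function with the sub-mean value property on complex lines of a
finite-dimensional Hilbert space has this property on analytic discs. -/
theorem SubMeanOn.le_circleAverage_comp {H : Type*} [NormedAddCommGroup H] [InnerProductSpace ℂ H]
    [ProperSpace H] {W : Set H} (hW : IsOpen W) {ψ : H → ℝ} (hψ : ContinuousOn ψ W)
    (hsub : SubMeanOn ψ W) {γ : ℂ → H} (hγ : Differentiable ℂ γ) {ρ : ℝ} (hρ : 0 < ρ)
    (hmaps : ∀ t ∈ Metric.closedBall (0 : ℂ) ρ, γ t ∈ W) :
    ψ (γ 0) ≤ Real.circleAverage (fun t => ψ (γ t)) 0 ρ := by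
  -- Maximise `F (t, y) = ψ (γ t + y) - Re h t + δ‖t‖² - C‖y‖²` over a product of closed balls.
  -- Positivity at the origin forces an interior maximum. Near it the disc is compared with its
  -- tangent line, the first-order small discrepancy being absorbed by `y`; the sub-mean value
  -- property on that line then contradicts maximality.
  by_contra! hlt
  have hγc := hγ.continuous
  have hu : ContinuousOn (fun t => ψ (γ t)) (Metric.closedBall 0 ρ) :=
    hψ.comp hγc.continuousOn hmaps
  have hus := hu.mono Metric.sphere_subset_closedBall
  obtain ⟨h, hd, hcen, ε, hε, hsph⟩ :=
    exists_differentiable_re_gt_of_circleAverage_lt (u := fun t => ψ (γ t)) hρ hus hlt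
  -- Small enough for the added term `δ‖t‖²` to leave the values over the boundary circle negative.
  obtain ⟨δ, hδ, hδε⟩ : ∃ δ : ℝ, 0 < δ ∧ δ * ρ ^ 2 = ε / 2 :=
    ⟨ε / 2 / ρ ^ 2, by positivity, by field_simp⟩
  have hKs := isCompact_sphere (0 : ℂ) ρ
  have hKb := isCompact_closedBall (0 : ℂ) ρ
  -- uniform neighbourhood of the disc
  have hnear : ∀ᶠ y in 𝓝 (0 : H), ∀ t ∈ Metric.sphere (0 : ℂ) ρ,
      ψ (γ t + y) - (h t).re + δ * ρ ^ 2 < 0 := by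
    refine hKs.eventually_forall_of_forall_eventually fun t ht => ?_
    have h1 : ContinuousAt (fun z : H × ℂ => γ z.2 + z.1) (0, t) := by fun_prop
    have h2 : ContinuousAt ψ (γ t + 0) := by
      rw [add_zero]
      exact hψ.continuousAt (hW.mem_nhds (hmaps t (Metric.sphere_subset_closedBall ht)))
    have h3 : ContinuousAt (fun z : H × ℂ => ψ (γ z.2 + z.1) - (h z.2).re + δ * ρ ^ 2) (0, t) := by
      have h4 : ContinuousAt (fun z : H × ℂ => ψ (γ z.2 + z.1)) (0, t) :=
        ContinuousAt.comp (g := ψ) h2 h1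
      have h5 : ContinuousAt (fun z : H × ℂ => (h z.2).re) (0, t) :=
        (Complex.continuous_re.comp (hd.continuous.comp continuous_snd)).continuousAt
      exact (h4.sub h5).add continuousAt_const
    refine h3.eventually_lt_const ?_
    simp only [add_zero]
    linarith [hsph t ht]
  obtain ⟨e, he, heW⟩ := Metric.nhds_basis_closedBall.eventually_iff.1
    ((eventually_add_mem_of_isCompact hKb hγc hW hmaps).and hnear)
  have hK : IsCompact (Metric.closedBall (0 : ℂ) ρ ×ˢ Metric.closedBall (0 : H) e) :=
    hKb.prod (isCompact_closedBall _ _)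
  let F₀ : ℂ × H → ℝ := fun p => ψ (γ p.1 + p.2) - (h p.1).re + δ * ‖p.1‖ ^ 2
  have hF₀ : ContinuousOn F₀ (Metric.closedBall (0 : ℂ) ρ ×ˢ Metric.closedBall (0 : H) e) := by
    have h1 : ContinuousOn (fun p : ℂ × H => ψ (γ p.1 + p.2))
        (Metric.closedBall (0 : ℂ) ρ ×ˢ Metric.closedBall (0 : H) e) :=
      hψ.comp (by fun_prop) fun p hp => (heW hp.2).1 _ hp.1
    have h2 := hd.continuous
    exact (h1.sub (by fun_prop)).add (by fun_prop)
  obtain ⟨M, hM⟩ := (hK.image_of_continuousOn hF₀).bddAbove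
  -- The penalty makes `F` negative on `‖y‖ = e`, so the maximum is not attained there.
  obtain ⟨C, hC, hCM⟩ : ∃ C : ℝ, 0 < C ∧ M < C * e ^ 2 :=
    ⟨(|M| + 1) / e ^ 2, by positivity, by
      rw [div_mul_cancel₀ _ (by positivity)]; linarith [le_abs_self M]⟩
  let F : ℂ × H → ℝ := fun p => F₀ p - C * ‖p.2‖ ^ 2
  have hF : ContinuousOn F (Metric.closedBall (0 : ℂ) ρ ×ˢ Metric.closedBall (0 : H) e) :=
    hF₀.sub (by fun_prop)
  have h0K : ((0 : ℂ), (0 : H)) ∈ Metric.closedBall (0 : ℂ) ρ ×ˢ Metric.closedBall (0 : H) e :=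
    ⟨Metric.mem_closedBall_self hρ.le, Metric.mem_closedBall_self he.le⟩
  obtain ⟨⟨t₀, y₀⟩, hpK, hmax⟩ := hK.exists_isMaxOn ⟨_, h0K⟩ hF
  have hpos : 0 < F (t₀, y₀) := by
    refine lt_of_lt_of_le ?_ (hmax h0K)
    simpa [F, F₀] using sub_pos.2 hcen
  have ht₀ : ‖t₀‖ < ρ := by
    refine lt_of_le_of_ne (mem_closedBall_zero_iff.1 hpK.1) fun heq => ?_
    have h1 := (heW hpK.2).2 t₀ (mem_sphere_zero_iff_norm.2 heq)
    have h2 : 0 ≤ C * ‖y₀‖ ^ 2 := by positivity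
    simp only [F, F₀, heq] at hpos
    linarith
  have hy₀ : ‖y₀‖ < e := by
    refine lt_of_le_of_ne (mem_closedBall_zero_iff.1 hpK.2) fun heq => ?_
    have h1 := hM (mem_image_of_mem F₀ hpK)
    simp only [F, heq] at hpos
    linarith
  -- the error between the disc and its tangent line
  set b := deriv γ t₀ with hb
  let η : ℂ → H := fun s => γ t₀ + s • b - γ (t₀ + s)
  have hηd : Differentiable ℂ η := by fun_prop
  have hη0 : η 0 = 0 := by simp [η]
  -- With `‖η s‖ ≤ κ‖s‖`, the loss `C‖η s‖²` stays below the gain `δ‖s‖²`.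
  obtain ⟨κ, hκ, hκC⟩ : ∃ κ : ℝ, 0 < κ ∧ C * κ ^ 2 < δ :=
    ⟨Real.sqrt (δ / (2 * C)), by positivity, by
      rw [Real.sq_sqrt (by positivity)]
      field_simp
      linarith⟩
  have hsmall : ∀ᶠ s in 𝓝 (0 : ℂ), ‖η s‖ ≤ κ * ‖s‖ := by
    have h1 := (hasDerivAt_iff_isLittleO_nhds_zero.1 (hγ t₀).hasDerivAt).bound hκ
    filter_upwards [h1] with s hs
    have h2 : η s = -(γ (t₀ + s) - γ t₀ - s • b) := by
      simp only [η]
      abel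
    rwa [h2, norm_neg]
  have hts : ∀ᶠ s in 𝓝 (0 : ℂ), ‖t₀ + s‖ < ρ := by
    have : Continuous fun s : ℂ => ‖t₀ + s‖ := by fun_prop
    exact this.continuousAt.eventually_lt_const (by simpa using ht₀)
  have hys : ∀ᶠ s in 𝓝 (0 : ℂ), ‖y₀ + η s‖ < e := by
    have h1 := hηd.continuous
    have : Continuous fun s : ℂ => ‖y₀ + η s‖ := by fun_prop
    exact this.continuousAt.eventually_lt_const (by simpa [hη0] using hy₀)
  obtain ⟨σ, hσ, hσs⟩ := Metric.nhds_basis_closedBall.eventually_iff.1 (hsmall.and (hts.and hys))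
  have hline : ∀ s, (γ t₀ + y₀) + s • b = γ (t₀ + s) + (y₀ + η s) := fun s => by
    simp only [η]; abel
  have hmem : ∀ s ∈ Metric.closedBall (0 : ℂ) σ, (γ t₀ + y₀) + s • b ∈ W := fun s hs => by
    rw [hline]
    obtain ⟨-, h1, h2⟩ := hσs hs
    exact (heW (mem_closedBall_zero_iff.2 h2.le)).1 _ (mem_closedBall_zero_iff.2 h1.le)
  have hmean := hsub (γ t₀ + y₀) b σ hσ hmem
  -- Solve `F (t₀ + s, y₀ + η s) ≤ F (t₀, y₀)` for `ψ` on the tangent line and expand both squared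
  -- norms. The cross terms are real parts of holomorphic functions of `s`, and on `‖s‖ = σ` the
  -- pure squares are constant or bounded by a constant.
  let Q : ℂ → ℂ := fun s => h (t₀ + s) - 2 * δ * (starRingEnd ℂ t₀ * s)
    + 2 * C * inner ℂ y₀ (η s)
    + ((F (t₀, y₀) - δ * ‖t₀‖ ^ 2 - δ * σ ^ 2 + C * ‖y₀‖ ^ 2 + C * κ ^ 2 * σ ^ 2 : ℝ) : ℂ)
  have hQd : Differentiable ℂ Q := by
    have : Differentiable ℂ fun s => inner ℂ y₀ (η s) :=
      (innerSL ℂ y₀).differentiable.comp hηd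
    fun_prop
  have hcont : ContinuousOn (fun s : ℂ => ψ ((γ t₀ + y₀) + s • b)) (Metric.sphere 0 σ) :=
    hψ.comp (by fun_prop) fun s hs => hmem s (Metric.sphere_subset_closedBall hs)
  have hbound : ∀ s ∈ Metric.sphere (0 : ℂ) σ, ψ ((γ t₀ + y₀) + s • b) ≤ (Q s).re := by
    intro s hs
    obtain ⟨h0, h1, h2⟩ := hσs (Metric.sphere_subset_closedBall hs)
    have hs' : ‖s‖ = σ := mem_sphere_zero_iff_norm.1 hs
    have h3 : F (t₀ + s, y₀ + η s) ≤ F (t₀, y₀) :=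
      hmax ⟨mem_closedBall_zero_iff.2 h1.le, mem_closedBall_zero_iff.2 h2.le⟩
    have e1 : ‖t₀ + s‖ ^ 2 = ‖t₀‖ ^ 2 + 2 * (starRingEnd ℂ t₀ * s).re + σ ^ 2 := by
      rw [← hs']
      have := norm_add_sq (𝕜 := ℂ) t₀ s
      simpa [mul_comm] using this
    have e2 : ‖y₀ + η s‖ ^ 2 = ‖y₀‖ ^ 2 + 2 * (inner ℂ y₀ (η s)).re + ‖η s‖ ^ 2 :=
      norm_add_sq (𝕜 := ℂ) y₀ (η s)
    have e3 : ‖η s‖ ^ 2 ≤ κ ^ 2 * σ ^ 2 := by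
      rw [← mul_pow, ← hs']
      gcongr
    have e4 : (Q s).re = (h (t₀ + s)).re - 2 * δ * (starRingEnd ℂ t₀ * s).re
        + 2 * C * (inner ℂ y₀ (η s)).re
        + (F (t₀, y₀) - δ * ‖t₀‖ ^ 2 - δ * σ ^ 2 + C * ‖y₀‖ ^ 2 + C * κ ^ 2 * σ ^ 2) := by
      have r1 : ∀ (x : ℝ) (z : ℂ), ((2 : ℂ) * x * z).re = 2 * x * z.re := fun x z => by
        rw [← Complex.ofReal_ofNat, ← Complex.ofReal_mul, Complex.re_ofReal_mul]
      simp only [Q, Complex.add_re, Complex.sub_re, r1, Complex.ofReal_re]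
    have e5 : C * ‖η s‖ ^ 2 ≤ C * (κ ^ 2 * σ ^ 2) := by gcongr
    have e6 : F (t₀ + s, y₀ + η s) = ψ ((γ t₀ + y₀) + s • b) - (h (t₀ + s)).re
        + δ * ‖t₀ + s‖ ^ 2 - C * ‖y₀ + η s‖ ^ 2 := by
      simp only [F, F₀, hline]
    rw [e6, e1, e2] at h3
    rw [e4]
    linarith
  have hfin := hmean.trans (circleAverage_le_re_of_le hσ.le hcont hQd hbound)
  have hQ0 : (Q 0).re = ψ (γ t₀ + y₀) - δ * σ ^ 2 + C * κ ^ 2 * σ ^ 2 := by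
    simp only [Q, hη0, inner_zero_right, mul_zero, add_zero, sub_zero, Complex.add_re,
      Complex.ofReal_re, F, F₀]
    ring
  rw [hQ0] at hfin
  have : C * κ ^ 2 * σ ^ 2 < δ * σ ^ 2 := by gcongr
  linarith

/-- A continuous function with the sub-mean value property on complex lines has this property on
polynomial discs. -/
theorem SubMeanOn.le_circleAverage_polynomial {E : Type*} [NormedAddCommGroup E] [NormedSpace ℂ E]
    {B : Set E} (hB : IsOpen B) {φ : E → ℝ} (hφ : ContinuousOn φ B) (hsub : SubMeanOn φ B)
    (n : ℕ) (a : ℕ → E) {ρ : ℝ} (hρ : 0 < ρ)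
    (hmaps : ∀ t ∈ Metric.closedBall (0 : ℂ) ρ, ∑ k ∈ Finset.range n, t ^ k • a k ∈ B) :
    φ (∑ k ∈ Finset.range n, (0 : ℂ) ^ k • a k) ≤
      Real.circleAverage (fun t => φ (∑ k ∈ Finset.range n, t ^ k • a k)) 0 ρ := by
  -- The polynomial disc is the image under the linear map `L` of the moment curve `t ↦ (1, t, …, t
  -- ^ (n - 1))`, and `φ ∘ L` inherits the sub-mean value property on lines.
  let L : EuclideanSpace ℂ (Fin n) →L[ℂ] E :=
    ∑ k : Fin n, (EuclideanSpace.proj k : EuclideanSpace ℂ (Fin n) →L[ℂ] ℂ).smulRight (a k)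
  let γ : ℂ → EuclideanSpace ℂ (Fin n) := fun t => WithLp.toLp 2 fun k => t ^ (k : ℕ)
  have hγ : Differentiable ℂ γ := by
    refine (differentiable_euclidean (𝕜 := ℂ)).2 fun k => ?_
    simp only [γ]
    fun_prop
  have hL : ∀ t, L (γ t) = ∑ k ∈ Finset.range n, t ^ k • a k := fun t => by
    simp [L, γ, Finset.sum_range]
  have key := SubMeanOn.le_circleAverage_comp (W := L ⁻¹' B) (ψ := φ ∘ L)
    (hB.preimage L.continuous) (hφ.comp L.continuous.continuousOn fun _ hx => hx)
    (fun x b r hr h => by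
      simpa using hsub (L x) (L b) r hr fun t ht => by simpa using h t ht)
    hγ hρ (fun t ht => by simpa only [mem_preimage, hL] using hmaps t ht)
  simpa only [Function.comp_apply, hL] using key

/-- A continuous function with the sub-mean value property on complex lines of a Banach space has
this property on analytic discs. -/
theorem SubMeanOn.le_circleAverage_disc {E : Type*} [NormedAddCommGroup E] [NormedSpace ℂ E]
    [CompleteSpace E] {B : Set E} (hB : IsOpen B) {φ : E → ℝ} (hφ : ContinuousOn φ B)
    (hsub : SubMeanOn φ B) {G : ℂ → E} {ρ R : ℝ} (hρ : 0 < ρ) (hρR : ρ < R)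
    (hG : DifferentiableOn ℂ G (Metric.ball 0 R)) (hmaps : ∀ t ∈ Metric.ball (0 : ℂ) R, G t ∈ B) :
    φ (G 0) ≤ Real.circleAverage (fun t => φ (G t)) 0 ρ := by
  obtain ⟨R', h₁, h₂⟩ := exists_between hρR
  lift R' to NNReal using (hρ.trans h₁).le
  have hps := (hG.mono (Metric.closedBall_subset_ball h₂)).hasFPowerSeriesOnBall
    (NNReal.coe_pos.1 (hρ.trans h₁))
  set p := cauchyPowerSeries G 0 R'
  have hpart : ∀ n t, p.partialSum n t = ∑ k ∈ Finset.range n, t ^ k • p.coeff k := fun n t => by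
    simp [FormalMultilinearSeries.partialSum]
  have hKR : Metric.closedBall (0 : ℂ) ρ ⊆ Metric.ball 0 R := Metric.closedBall_subset_ball hρR
  -- The Taylor polynomials of `G` at `0` serve as approximating discs. The radius `R'` lies
  -- strictly between `ρ` and `R` to make the convergence uniform on the closed disc of radius `ρ`.
  have hunif : TendstoUniformlyOn (fun n t => p.partialSum n t) G atTop
      (Metric.closedBall 0 ρ) := by
    lift ρ to NNReal using hρ.le
    obtain ⟨ρ', h₃, h₄⟩ := exists_between h₁
    lift ρ' to NNReal using ρ.2.trans h₃.le
    have := hps.tendstoUniformlyOn (r' := ρ') (by exact_mod_cast h₄)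
    simp only [zero_add] at this
    exact this.mono (Metric.closedBall_subset_ball h₃)
  have hK := isCompact_closedBall (0 : ℂ) ρ
  have hGc : ContinuousOn G (Metric.closedBall 0 ρ) := hG.continuousOn.mono hKR
  have hφG : ContinuousOn (fun t => φ (G t)) (Metric.closedBall 0 ρ) :=
    hφ.comp hGc fun t ht => hmaps t (hKR ht)
  refine le_of_forall_pos_le_add fun ε hε => ?_
  have hnear : ∀ᶠ y in 𝓝 (0 : E), ∀ t ∈ Metric.closedBall (0 : ℂ) ρ,
      G t + y ∈ B ∧ |φ (G t + y) - φ (G t)| < ε / 2 := by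
    refine hK.eventually_forall_of_forall_eventually fun t ht => ?_
    have htR := Metric.isOpen_ball.mem_nhds (hKR ht)
    have hGt : ContinuousAt G t := hG.continuousOn.continuousAt htR
    have h3 : ContinuousAt (fun z : E × ℂ => G z.2) (0, t) :=
      ContinuousAt.comp (g := G) hGt continuousAt_snd
    have h4 : ContinuousAt (fun z : E × ℂ => G z.2 + z.1) (0, t) := h3.add continuousAt_fst
    have hBt : B ∈ 𝓝 (G t) := hB.mem_nhds (hmaps t (hKR ht))
    have h5 : ContinuousAt (fun z : E × ℂ => φ (G z.2 + z.1)) (0, t) :=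
      ContinuousAt.comp (g := φ) (by simpa using hφ.continuousAt hBt) h4
    have h6 : ContinuousAt (fun z : E × ℂ => φ (G z.2)) (0, t) :=
      ContinuousAt.comp (g := φ) (hφ.continuousAt hBt) h3
    refine (h4.eventually_mem (by simpa using hBt)).and ?_
    exact (h5.sub h6).abs.eventually_lt_const (by simpa using hε)
  obtain ⟨d, hd, hdW⟩ := Metric.eventually_nhds_iff.1 hnear
  obtain ⟨n, hn⟩ := (Metric.tendstoUniformlyOn_iff.1 hunif d hd).exists
  have hn' : ∀ t ∈ Metric.closedBall (0 : ℂ) ρ, (∑ k ∈ Finset.range n, t ^ k • p.coeff k) ∈ B ∧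
      |φ (∑ k ∈ Finset.range n, t ^ k • p.coeff k) - φ (G t)| < ε / 2 := fun t ht => by
    have h3 := hn t ht
    rw [dist_comm, dist_eq_norm, hpart] at h3
    have h4 := hdW (y := ∑ k ∈ Finset.range n, t ^ k • p.coeff k - G t) (by simpa using h3) t ht
    rwa [add_sub_cancel] at h4
  have key := hsub.le_circleAverage_polynomial hB hφ n p.coeff hρ fun t ht => (hn' t ht).1
  have h0 := abs_lt.1 (hn' 0 (Metric.mem_closedBall_self hρ.le)).2
  have hc1 : ContinuousOn (fun t : ℂ => φ (∑ k ∈ Finset.range n, t ^ k • p.coeff k))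
      (Metric.sphere 0 ρ) :=
    hφ.comp (by fun_prop) fun t ht => (hn' t (Metric.sphere_subset_closedBall ht)).1
  have hc2 := hφG.mono Metric.sphere_subset_closedBall
  have hmono : Real.circleAverage (fun t : ℂ => φ (∑ k ∈ Finset.range n, t ^ k • p.coeff k)) 0 ρ ≤
      Real.circleAverage (fun t => φ (G t) + ε / 2) 0 ρ := by
    refine Real.circleAverage_mono (hc1.circleIntegrable hρ.le)
      ((hc2.add continuousOn_const).circleIntegrable hρ.le) fun t ht => ?_
    rw [abs_of_pos hρ] at ht
    linarith [(abs_lt.1 (hn' t (Metric.sphere_subset_closedBall ht)).2).2]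
  rw [Real.circleAverage_fun_add (hc2.circleIntegrable hρ.le)
    (continuousOn_const.circleIntegrable hρ.le), Real.circleAverage_const] at hmono
  linarith

/-- By continuity a single negative value would make the average strictly negative. This is the
equality case needed for the maximum principle. -/
theorem eq_of_circleAverage_nonneg {f : ℂ → ℝ} {c : ℂ} {r : ℝ} (hr : 0 < r)
    (hf : ContinuousOn f (Metric.sphere c r)) (hle : ∀ z ∈ Metric.sphere c r, f z ≤ 0)
    (havg : 0 ≤ Real.circleAverage f c r) : ∀ z ∈ Metric.sphere c r, f z = 0 := by
  intro z hz
  refine le_antisymm (hle z hz) ?_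
  by_contra! hlt
  rw [← abs_of_pos hr, ← image_circleMap_Ioc] at hz
  obtain ⟨θ, hθ, rfl⟩ := hz
  have hc : ContinuousOn (fun θ => f (circleMap c r θ)) (Icc 0 (2 * Real.pi)) :=
    hf.comp (by fun_prop) fun θ _ => circleMap_mem_sphere c hr.le θ
  have := intervalIntegral.integral_lt_integral_of_continuousOn_of_le_of_exists_lt
    Real.two_pi_pos hc continuousOn_const (fun θ _ => hle _ (circleMap_mem_sphere c hr.le θ))
    ⟨θ, Ioc_subset_Icc_self hθ, hlt⟩
  rw [intervalIntegral.integral_zero] at this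
  rw [Real.circleAverage_def, smul_eq_mul] at havg
  have h2 : 0 < (2 * Real.pi)⁻¹ := inv_pos.2 Real.two_pi_pos
  exact absurd havg (not_le.2 (mul_neg_of_pos_of_neg h2 this))

/-! ### Limits of bounded sequences of holomorphic functions -/

theorem Ultrafilter.exists_tendsto_of_eventually_norm_le {ι : Type*} (𝒰 : Ultrafilter ι)
    {f : ι → ℂ} {M : ℝ} (h : ∀ᶠ i in (𝒰 : Filter ι), ‖f i‖ ≤ M) : ∃ l, Tendsto f 𝒰 (𝓝 l) := by
  obtain ⟨l, -, hl⟩ := (isCompact_closedBall (0 : ℂ) M).ultrafilter_le_nhds' (𝒰.map f)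
    (h.mono fun i hi => mem_closedBall_zero_iff.2 hi)
  exact ⟨l, hl⟩

/-- A pointwise limit, along an ultrafilter, of uniformly bounded holomorphic functions on a ball
of a normed space is holomorphic. -/
theorem differentiableOn_of_tendsto_ultrafilter {ι F : Type*} [NormedAddCommGroup F]
    [NormedSpace ℂ F] {𝒰 : Ultrafilter ι} {c : F} {r M : ℝ} {f : ι → F → ℂ} {L : F → ℂ}
    (hd : ∀ᶠ i in (𝒰 : Filter ι), DifferentiableOn ℂ (f i) (Metric.ball c r))
    (hb : ∀ᶠ i in (𝒰 : Filter ι), ∀ x ∈ Metric.ball c r, ‖f i x‖ ≤ M)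
    (hL : ∀ x ∈ Metric.ball c r, Tendsto (fun i => f i x) 𝒰 (𝓝 (L x))) :
    DifferentiableOn ℂ L (Metric.ball c r) := by
  intro x hx
  obtain ⟨R, hR, hRr⟩ := Metric.isOpen_ball.mem_nhds hx |> Metric.mem_nhds_iff.1
  have hmapsTo : ∀ᶠ i in (𝒰 : Filter ι),
      MapsTo (f i) (Metric.ball x R) (Metric.closedBall (f i x) (M + M)) := by
    filter_upwards [hb] with i hi z hz
    rw [mem_closedBall_iff_norm]
    exact (norm_sub_le _ _).trans (add_le_add (hi z (hRr hz)) (hi x hx))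
  have hfd : ∀ᶠ i in (𝒰 : Filter ι), ‖fderiv ℂ (f i) x‖ ≤ (M + M) / R := by
    filter_upwards [hd, hmapsTo] with i hi hm
    exact Complex.norm_fderiv_le_div_of_mapsTo_ball (hi.mono hRr) hm hR
  have hM : 0 ≤ (M + M) / R := by
    obtain ⟨i, hi⟩ := hfd.exists
    exact (norm_nonneg _).trans hi
  have hfdv : ∀ v, ∀ᶠ i in (𝒰 : Filter ι), ‖fderiv ℂ (f i) x v‖ ≤ (M + M) / R * ‖v‖ := fun v => by
    filter_upwards [hfd] with i hi
    exact ((fderiv ℂ (f i) x).le_opNorm v).trans (by gcongr)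
  choose D hD using fun v => 𝒰.exists_tendsto_of_eventually_norm_le (hfdv v)
  -- The candidate derivative is the pointwise ultralimit of the derivatives of the `f i`, which
  -- Cauchy's estimate bounds uniformly.
  let D' : F →L[ℂ] ℂ := LinearMap.mkContinuous
    { toFun := D
      map_add' := fun v v' => tendsto_nhds_unique (hD (v + v'))
        (by simpa only [map_add] using (hD v).add (hD v'))
      map_smul' := fun a v => tendsto_nhds_unique (hD (a • v))
        (by simpa only [map_smul, RingHom.id_apply] using (hD v).const_smul a) }
    ((M + M) / R) fun v => le_of_tendsto (hD v).norm (hfdv v)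
  -- Each `f i` minus its linear part is bounded and constant up to `o(‖z - x‖)`, so the
  -- higher-order Schwarz lemma gives a quadratic remainder with a constant independent of `i`,
  -- which survives the limit.
  have hest : ∀ z ∈ Metric.ball x R,
      ‖L z - L x - D' (z - x)‖ ≤ (M + M + (M + M)) / R ^ 2 * ‖z - x‖ ^ 2 := by
    intro z hz
    have hlim : Tendsto (fun i => ‖f i z - f i x - fderiv ℂ (f i) x (z - x)‖) 𝒰
        (𝓝 ‖L z - L x - D' (z - x)‖) :=
      (((hL z (hRr hz)).sub (hL x hx)).sub (hD (z - x))).norm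
    refine le_of_tendsto hlim ?_
    filter_upwards [hd, hmapsTo, hfd] with i hi hm hf
    have hix : HasFDerivAt (f i) (fderiv ℂ (f i) x) x :=
      ((hi x hx).differentiableAt (Metric.isOpen_ball.mem_nhds hx)).hasFDerivAt
    let g : F → ℂ := fun z => f i z - fderiv ℂ (f i) x (z - x)
    have hgx : g x = f i x := by simp [g]
    have hgd : DifferentiableOn ℂ g (Metric.ball x R) :=
      (hi.mono hRr).sub (by fun_prop)
    have hgm : MapsTo g (Metric.ball x R) (Metric.closedBall (g x) (M + M + (M + M))) := by
      intro y hy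
      rw [mem_closedBall_iff_norm, hgx]
      have h1 : g y - f i x = (f i y - f i x) - fderiv ℂ (f i) x (y - x) := by
        simp only [g]; ring
      rw [h1]
      refine (norm_sub_le _ _).trans (add_le_add (mem_closedBall_iff_norm.1 (hm hy)) ?_)
      calc ‖fderiv ℂ (f i) x (y - x)‖ ≤ (M + M) / R * ‖y - x‖ :=
            ((fderiv ℂ (f i) x).le_opNorm _).trans (by gcongr)
        _ ≤ (M + M) / R * R := by
            have := (mem_ball_iff_norm.1 hy).le
            gcongr
        _ = M + M := div_mul_cancel₀ _ hR.ne'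
    have hgo : (g · - g x) =o[𝓝 x] (fun y => ‖y - x‖ ^ 1) := by
      have := hix.isLittleO.norm_right
      simp only [pow_one]
      refine this.congr_left fun y => ?_
      rw [hgx]
      simp only [g]
      ring
    have := Complex.dist_le_mul_div_pow_of_mapsTo_ball_of_isLittleO hgd hgm hgo hz
    rw [dist_eq_norm, dist_eq_norm, hgx] at this
    calc ‖f i z - f i x - fderiv ℂ (f i) x (z - x)‖ = ‖g z - f i x‖ := by
          congr 1; simp only [g]; ring
      _ ≤ _ := this
      _ = _ := by rw [div_pow]; ring
  refine HasFDerivWithinAt.differentiableWithinAt (f' := D') (HasFDerivAt.hasFDerivWithinAt ?_)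
  refine HasFDerivAt.of_isLittleO ?_
  have hO : (fun z => L z - L x - D' (z - x)) =O[𝓝 x] fun z => ‖z - x‖ ^ 2 := by
    refine Asymptotics.IsBigO.of_bound ((M + M + (M + M)) / R ^ 2) ?_
    filter_upwards [Metric.ball_mem_nhds x hR] with z hz
    simpa using hest z hz
  exact hO.trans_isLittleO (Asymptotics.isLittleO_pow_sub_sub x one_lt_two)

/-! ### Holomorphic mappings in charts -/

section Charts

variable {F : Type*} [NormedAddCommGroup F] {A : Type*} [TopologicalSpace A] [ChartedSpace F A]

theorem exists_ball_chartAt {a : A} {V : Set A} (hV : V ∈ 𝓝 a) :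
    ∃ r > 0, Metric.ball (chartAt F a a) r ⊆ (chartAt F a).target ∧
      ∀ y ∈ Metric.ball (chartAt F a a) r, (chartAt F a).symm y ∈ V := by
  have h1 : (chartAt F a).target ∈ 𝓝 (chartAt F a a) :=
    (chartAt F a).open_target.mem_nhds (mem_chart_target F a)
  have h2 : ∀ᶠ y in 𝓝 (chartAt F a a), (chartAt F a).symm y ∈ V :=
    ((chartAt F a).tendsto_symm (mem_chart_source F a)).eventually hV
  obtain ⟨r, hr, h⟩ := Metric.eventually_nhds_iff_ball.1 ((eventually_mem_set.2 h1).and h2)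
  exact ⟨r, hr, fun y hy => (h y hy).1, fun y hy => (h y hy).2⟩

variable [NormedSpace ℂ F]

theorem mdifferentiableOn_symm_of_mem_maximalAtlas_omega {e : OpenPartialHomeomorph A F}
    (he : e ∈ IsManifold.maximalAtlas 𝓘(ℂ, F) ω A) :
    MDifferentiableOn 𝓘(ℂ, F) 𝓘(ℂ, F) e.symm e.target :=
  (contMDiffOn_symm_of_mem_maximalAtlas he).mdifferentiableOn (by simp)

theorem mdifferentiableOn_of_mem_maximalAtlas_omega {e : OpenPartialHomeomorph A F}
    (he : e ∈ IsManifold.maximalAtlas 𝓘(ℂ, F) ω A) :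
    MDifferentiableOn 𝓘(ℂ, F) 𝓘(ℂ, F) e e.source :=
  (contMDiffOn_of_mem_maximalAtlas he).mdifferentiableOn (by simp)

variable [IsManifold 𝓘(ℂ, F) ω A]

theorem MDifferentiable.differentiableOn_comp_chartAt_symm {f : A → ℂ}
    (hf : MDifferentiable 𝓘(ℂ, F) 𝓘(ℂ, ℂ) f) (a : A) :
    DifferentiableOn ℂ (fun y => f ((chartAt F a).symm y)) (chartAt F a).target :=
  mdifferentiableOn_iff_differentiableOn.1 <| hf.comp_mdifferentiableOn <|
    mdifferentiableOn_symm_of_mem_maximalAtlas_omega (IsManifold.chart_mem_maximalAtlas a)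

theorem mdifferentiableAt_of_differentiableOn_comp_chartAt_symm {f : A → ℂ} {a : A} {r : ℝ}
    (hr : 0 < r)
    (hf : DifferentiableOn ℂ (fun y => f ((chartAt F a).symm y)) (Metric.ball (chartAt F a a) r)) :
    MDifferentiableAt 𝓘(ℂ, F) 𝓘(ℂ, ℂ) f a := by
  have h1 : MDifferentiableAt 𝓘(ℂ, F) 𝓘(ℂ, F) (chartAt F a) a :=
    (mdifferentiableOn_of_mem_maximalAtlas_omega (IsManifold.chart_mem_maximalAtlas a)).mdifferentiableAt
      ((chartAt F a).open_source.mem_nhds (mem_chart_source F a))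
  have h2 : MDifferentiableAt 𝓘(ℂ, F) 𝓘(ℂ, ℂ) (fun y => f ((chartAt F a).symm y))
      (chartAt F a a) :=
    mdifferentiableAt_iff_differentiableAt.2
      (hf.differentiableAt (Metric.ball_mem_nhds _ hr))
  refine (h2.comp a h1).congr_of_eventuallyEq ?_
  filter_upwards [(chartAt F a).open_source.mem_nhds (mem_chart_source F a)] with x hx
  simp [(chartAt F a).left_inv hx]

/-- Vitali's theorem for locally bounded sequences of scalar holomorphic functions. -/
theorem exists_tendsto_uncurry_of_locally_bounded [ConnectedSpace A] {f : ℕ → A → ℂ}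
    (hf : ∀ k, MDifferentiable 𝓘(ℂ, F) 𝓘(ℂ, ℂ) (f k))
    (hb : ∀ a, ∃ M : ℝ, ∀ᶠ p : ℕ × A in atTop ×ˢ 𝓝 a, ‖f p.1 p.2‖ ≤ M)
    {S : Set A} (hS : S ⊆ convergenceSet f) (hne : (uniquenessPoints F S).Nonempty) :
    ∃ g : A → ℂ, MDifferentiable 𝓘(ℂ, F) 𝓘(ℂ, ℂ) g ∧
      ∀ a, Tendsto (fun p : ℕ × A => f p.1 p.2) (atTop ×ˢ 𝓝 a) (𝓝 (g a)) := by
  have hloc : ∀ a, ∃ r > 0, ∃ M : ℝ,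
      Metric.ball (chartAt F a a) r ⊆ (chartAt F a).target ∧
      ∀ᶠ k in atTop, ∀ y ∈ Metric.ball (chartAt F a a) r,
        ‖f k ((chartAt F a).symm y)‖ ≤ M := by
    intro a
    obtain ⟨M, hM⟩ := hb a
    obtain ⟨P, hP, Q, hQ, hPQ⟩ := eventually_prod_iff.1 hM
    obtain ⟨r, hr, h1, h2⟩ := exists_ball_chartAt (F := F) hQ
    exact ⟨r, hr, M, h1, hP.mono fun k hk y hy => hPQ hk (h2 y hy)⟩
  have hlim : ∀ (𝒰 : Ultrafilter ℕ), (𝒰 : Filter ℕ) ≤ atTop →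
      ∃ L : A → ℂ, MDifferentiable 𝓘(ℂ, F) 𝓘(ℂ, ℂ) L ∧
        ∀ a, Tendsto (fun k => f k a) 𝒰 (𝓝 (L a)) := by
    intro 𝒰 h𝒰
    have h1 : ∀ a, ∃ l, Tendsto (fun k => f k a) 𝒰 (𝓝 l) := fun a => by
      obtain ⟨r, hr, M, -, hM⟩ := hloc a
      refine 𝒰.exists_tendsto_of_eventually_norm_le (M := M) (h𝒰 ?_)
      filter_upwards [hM] with k hk
      have := hk _ (Metric.mem_ball_self hr)
      rwa [(chartAt F a).left_inv (mem_chart_source F a)] at this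
    choose L hL using h1
    refine ⟨L, fun a => ?_, hL⟩
    obtain ⟨r, hr, M, hrt, hM⟩ := hloc a
    refine mdifferentiableAt_of_differentiableOn_comp_chartAt_symm hr ?_
    exact differentiableOn_of_tendsto_ultrafilter (𝒰 := 𝒰)
      (.of_forall fun k => ((hf k).differentiableOn_comp_chartAt_symm a).mono hrt)
      (h𝒰 hM) fun y _ => hL _
  obtain ⟨z, hz⟩ := hne
  obtain ⟨g, hg, hgt⟩ := hlim (hyperfilter ℕ) Nat.hyperfilter_le_atTop
  -- Every ultrafilter limit is holomorphic and agrees with `g` on `S`, hence everywhere by the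
  -- uniqueness point applied to the whole connected manifold. Agreement of all ultrafilter limits
  -- is ordinary convergence.
  have hpt : ∀ a, Tendsto (fun k => f k a) atTop (𝓝 (g a)) := by
    intro a
    refine (tendsto_iff_ultrafilter _ _ _).2 fun 𝒰 h𝒰 => ?_
    obtain ⟨L, hLd, hL⟩ := hlim 𝒰 h𝒰
    have h0 := hz.2 univ isOpen_univ isConnected_univ (mem_univ z) (fun x => L x - g x)
      (hLd.sub hg).mdifferentiableOn (fun x hx => by
        obtain ⟨l, hl⟩ := hS hx.2
        rw [tendsto_nhds_unique (hL x) (hl.mono_left h𝒰),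
          tendsto_nhds_unique (hgt x) (hl.mono_left Nat.hyperfilter_le_atTop), sub_self]) a
      (mem_univ a)
    rw [← sub_eq_zero.1 h0]
    exact hL a
  refine ⟨g, hg, fun a => ?_⟩
  obtain ⟨r, hr, M, hrt, hM⟩ := hloc a
  rw [tendsto_iff_dist_tendsto_zero]
  -- By the Schwarz lemma the bound `M` gives a Lipschitz estimate at the centre of the chart ball
  -- with constant `(M + M) / r`, which upgrades pointwise to continuous convergence.
  have hbound : Tendsto (fun p : ℕ × A =>
      (M + M) / r * dist (chartAt F a p.2) (chartAt F a a) + dist (f p.1 a) (g a))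
      (atTop ×ˢ 𝓝 a) (𝓝 0) := by
    have h1 : Tendsto (fun p : ℕ × A => chartAt F a p.2) (atTop ×ˢ 𝓝 a) (𝓝 (chartAt F a a)) :=
      ((chartAt F a).continuousAt (mem_chart_source F a)).tendsto.comp tendsto_snd
    have h2 := tendsto_iff_dist_tendsto_zero.1 ((hpt a).comp (tendsto_fst (g := 𝓝 a)))
    have h3 := ((tendsto_iff_dist_tendsto_zero.1 h1).const_mul ((M + M) / r)).add h2
    simpa using h3
  refine squeeze_zero' (.of_forall fun _ => dist_nonneg) ?_ hbound
  have hball : ∀ᶠ x in 𝓝 a, x ∈ (chartAt F a).source ∧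
      chartAt F a x ∈ Metric.ball (chartAt F a a) r :=
    (eventually_mem_set.2 ((chartAt F a).open_source.mem_nhds (mem_chart_source F a))).and
      (((chartAt F a).continuousAt (mem_chart_source F a)).eventually_mem
        (Metric.ball_mem_nhds _ hr))
  filter_upwards [hM.prod_mk hball] with ⟨k, x⟩ ⟨hk, hxs, hxb⟩
  refine (dist_triangle _ (f k a) _).trans (add_le_add ?_ le_rfl)
  have h4 := Complex.dist_le_div_mul_dist_of_mapsTo_ball (R₂ := M + M)
    (((hf k).differentiableOn_comp_chartAt_symm a).mono hrt) (fun y hy => by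
      rw [mem_closedBall_iff_norm]
      exact (norm_sub_le _ _).trans (add_le_add (hk _ hy) (hk _ (Metric.mem_ball_self hr)))) hxb
  rwa [(chartAt F a).left_inv (mem_chart_source F a), (chartAt F a).left_inv hxs] at h4

end Charts

/-! ### The maximum principle -/

theorem IsPSHOn.subMeanOn {E : Type*} [NormedAddCommGroup E] [NormedSpace ℂ E] {φ : E → EReal}
    {B : Set E} {ψ : E → ℝ} (h : IsPSHOn φ B) (hφ : ∀ x, φ x = ψ x) (hψ : ContinuousOn ψ B) :
    SubMeanOn ψ B := by
  intro a b r hr hB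
  have h1 := (h.2.2 a b).2.2 0 r hr hB
  rw [circleMean_eq_circleAverage hr.le (fun z _ => hφ _)
    (hψ.comp (by fun_prop) fun t ht => hB t (Metric.sphere_subset_closedBall ht))] at h1
  simp only [hφ, EReal.coe_le_coe_iff, zero_smul, add_zero] at h1
  exact h1

section MaximumPrinciple

variable {E : Type*} [NormedAddCommGroup E] [NormedSpace ℂ E] [CompleteSpace E]
  {X : Type*} [TopologicalSpace X] [ChartedSpace E X]
  {F : Type*} [NormedAddCommGroup F] [NormedSpace ℂ F]
  {A : Type*} [TopologicalSpace A] [ChartedSpace F A] [IsManifold 𝓘(ℂ, F) ω A]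

/-- The function `u ∘ g + log ‖w‖` is nonpositive and vanishes at `a`. On discs centred at `a` its
circle average is at least its value at the centre, because `log ‖w‖` is harmonic where `w ≠ 0`; so
it vanishes on the circle. -/
theorem eventually_norm_eq_exp_neg {φ : X → EReal} (hpsh : IsPSH E φ) {u : X → ℝ}
    (hu : Continuous u) (hφ : ∀ x, φ x = u x) {g : A → X}
    (hg : MDifferentiable 𝓘(ℂ, F) 𝓘(ℂ, E) g) {w : A → ℂ}
    (hw : MDifferentiable 𝓘(ℂ, F) 𝓘(ℂ, ℂ) w) (hle : ∀ a, ‖w a‖ ≤ Real.exp (-u (g a))) {a : A}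
    (ha : ‖w a‖ = Real.exp (-u (g a))) : ∀ᶠ x in 𝓝 a, ‖w x‖ = Real.exp (-u (g x)) := by
  obtain ⟨e, he, hae, c, r, het, hsub⟩ := hpsh (g a)
  have hes : ContinuousOn (fun y => u (e.symm y)) (Metric.ball c r) :=
    hu.comp_continuousOn (het ▸ e.continuousOn_symm)
  have hmean := hsub.subMeanOn (fun y => hφ _) hes
  have hwa : w a ≠ 0 := norm_ne_zero_iff.1 (ha ▸ (Real.exp_pos _).ne')
  have hV : {x | g x ∈ e.source ∧ w x ≠ 0} ∈ 𝓝 a :=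
    (hg.continuous.continuousAt.eventually_mem (e.open_source.mem_nhds hae)).and
      (hw.continuous.continuousAt.eventually_ne hwa)
  obtain ⟨δ, hδ, hδt, hδV⟩ := exists_ball_chartAt (F := F) hV
  set κ := chartAt F a
  have hκa : κ.symm (κ a) = a := κ.left_inv (mem_chart_source F a)
  suffices h : ∀ p ∈ Metric.ball (κ a) δ, ‖w (κ.symm p)‖ = Real.exp (-u (g (κ.symm p))) by
    filter_upwards [κ.open_source.mem_nhds (mem_chart_source F a),
      (κ.continuousAt (mem_chart_source F a)).eventually_mem (Metric.ball_mem_nhds _ hδ)]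
      with x hx hxb
    simpa only [κ.left_inv hx] using h _ hxb
  intro p hp
  rcases eq_or_ne p (κ a) with rfl | hne
  · rwa [hκa]
  have hd : 0 < ‖p - κ a‖ := norm_pos_iff.2 (sub_ne_zero.2 hne)
  let R := δ / ‖p - κ a‖
  have hR : 1 < R := (one_lt_div hd).2 (mem_ball_iff_norm.1 hp)
  -- Centred at `κ a`, with `p` on the unit circle at `t = 1`; the larger radius `R` leaves room
  -- around the closed unit disc.
  let ℓ : ℂ → F := fun t => κ a + t • (p - κ a)
  have hℓ : ∀ t ∈ Metric.ball (0 : ℂ) R, ℓ t ∈ Metric.ball (κ a) δ := fun t ht => by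
    rw [mem_ball_iff_norm, add_sub_cancel_left, norm_smul]
    exact (lt_div_iff₀ hd).1 (mem_ball_zero_iff.1 ht)
  have hℓd : MDifferentiableOn 𝓘(ℂ, ℂ) 𝓘(ℂ, F) (fun t => κ.symm (ℓ t)) (Metric.ball 0 R) := by
    refine (mdifferentiableOn_symm_of_mem_maximalAtlas_omega
      (IsManifold.chart_mem_maximalAtlas a)).comp ?_ fun t ht => hδt (hℓ t ht)
    exact mdifferentiableOn_iff_differentiableOn.2 (by fun_prop)
  let G : ℂ → E := fun t => e (g (κ.symm (ℓ t)))
  have hGd : DifferentiableOn ℂ G (Metric.ball 0 R) :=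
    mdifferentiableOn_iff_differentiableOn.1 <|
      (mdifferentiableOn_of_mem_maximalAtlas_omega he).comp
        (hg.comp_mdifferentiableOn hℓd) fun t ht => (hδV _ (hℓ t ht)).1
  have hwd : DifferentiableOn ℂ (fun t => w (κ.symm (ℓ t))) (Metric.ball 0 R) :=
    mdifferentiableOn_iff_differentiableOn.1 (hw.comp_mdifferentiableOn hℓd)
  have hGm : ∀ t ∈ Metric.ball (0 : ℂ) R, G t ∈ Metric.ball c r := fun t ht =>
    het ▸ e.map_source (hδV _ (hℓ t ht)).1
  have h1R : Metric.closedBall (0 : ℂ) 1 ⊆ Metric.ball 0 R := Metric.closedBall_subset_ball hR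
  have hs1 : Metric.sphere (0 : ℂ) 1 ⊆ Metric.ball 0 R := Metric.sphere_subset_closedBall.trans h1R
  have hinv : ∀ t ∈ Metric.ball (0 : ℂ) R, e.symm (G t) = g (κ.symm (ℓ t)) := fun t ht =>
    e.left_inv (hδV _ (hℓ t ht)).1
  have key := hmean.le_circleAverage_disc Metric.isOpen_ball hes one_pos hR hGd hGm
  have hlog : Real.circleAverage (fun t => Real.log ‖w (κ.symm (ℓ t))‖) 0 1
      = Real.log ‖w (κ.symm (ℓ 0))‖ := by
    refine AnalyticOnNhd.circleAverage_log_norm_of_ne_zero (g := fun t => w (κ.symm (ℓ t)))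
      ((hwd.analyticOnNhd Metric.isOpen_ball).mono ?_) fun t ht => (hδV _ (hℓ t (h1R ?_))).2
    · simpa using h1R
    · simpa using ht
  have hℓ0 : ℓ 0 = κ a := by simp [ℓ]
  have hℓ1 : ℓ 1 = p := by simp [ℓ]
  have hc1 : ContinuousOn (fun t => u (e.symm (G t))) (Metric.sphere 0 1) :=
    hes.comp (hGd.continuousOn.mono hs1) fun t ht => hGm t (hs1 ht)
  have hc2 : ContinuousOn (fun t => Real.log ‖w (κ.symm (ℓ t))‖) (Metric.sphere 0 1) :=
    (hwd.continuousOn.mono hs1).norm.log fun t ht =>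
      norm_ne_zero_iff.2 (hδV _ (hℓ t (hs1 ht))).2
  have h0 := eq_of_circleAverage_nonneg one_pos (hc1.add hc2) (fun t ht => by
      have h2 := Real.log_le_log (norm_pos_iff.2 (hδV _ (hℓ t (hs1 ht))).2) (hle (κ.symm (ℓ t)))
      rw [Real.log_exp] at h2
      simp only [Pi.add_apply, hinv t (hs1 ht)]
      linarith) (by
      rw [Real.circleAverage_add (hc1.circleIntegrable zero_le_one)
        (hc2.circleIntegrable zero_le_one), hlog, hℓ0, hκa, ha, Real.log_exp]
      have h3 : e.symm (G 0) = g a := by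
        rw [hinv 0 (Metric.mem_ball_self (one_pos.trans hR)), hℓ0, hκa]
      rw [h3] at key
      linarith) 1 (by simp)
  simp only [Pi.add_apply, hinv 1 (hs1 (by simp)), hℓ1] at h0
  have hwp : 0 < ‖w (κ.symm p)‖ := norm_pos_iff.2 (hδV _ hp).2
  rw [← Real.exp_log hwp]
  congr 1
  linarith

/-- The set where equality holds is closed by continuity and open by `eventually_norm_eq_exp_neg`;
since `a₀` lies outside it, connectedness leaves it empty. -/
theorem norm_lt_exp_neg [ConnectedSpace A] {φ : X → EReal} (hpsh : IsPSH E φ) {u : X → ℝ}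
    (hu : Continuous u) (hφ : ∀ x, φ x = u x) {g : A → X}
    (hg : MDifferentiable 𝓘(ℂ, F) 𝓘(ℂ, E) g) {w : A → ℂ}
    (hw : MDifferentiable 𝓘(ℂ, F) 𝓘(ℂ, ℂ) w) (hle : ∀ a, ‖w a‖ ≤ Real.exp (-u (g a))) {a₀ : A}
    (ha₀ : ‖w a₀‖ < Real.exp (-u (g a₀))) (a : A) : ‖w a‖ < Real.exp (-u (g a)) := by
  have hclopen : IsClopen {a | ‖w a‖ = Real.exp (-u (g a))} := by
    refine ⟨isClosed_eq hw.continuous.norm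
      (Real.continuous_exp.comp (hu.comp hg.continuous).neg), ?_⟩
    rw [isOpen_iff_mem_nhds]
    exact fun a ha => eventually_norm_eq_exp_neg hpsh hu hφ hg hw hle ha
  rcases isClopen_iff.1 hclopen with h | h
  · refine lt_of_le_of_ne (hle a) fun heq => ?_
    exact h.le (show a ∈ {a | ‖w a‖ = Real.exp (-u (g a))} from heq)
  · exact absurd (h.ge (mem_univ a₀)) ha₀.ne

end MaximumPrinciple

/-! ### Convergence of mappings into a Hartogs domain -/

theorem uniquenessPoints_mono {F : Type*} [NormedAddCommGroup F] [NormedSpace ℂ F]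
    {A : Type*} [TopologicalSpace A] [ChartedSpace F A] {S T : Set A} (h : S ⊆ T) :
    uniquenessPoints F S ⊆ uniquenessPoints F T := fun _ hz =>
  ⟨closure_mono h hz.1, fun U hU hUc hzU f hf hfT =>
    hz.2 U hU hUc hzU f hf fun x hx => hfT x ⟨hx.1, h hx.2⟩⟩

section HartogsConvergence

variable {E : Type*} [NormedAddCommGroup E] [NormedSpace ℂ E]
  {X : Type*} [TopologicalSpace X] [ChartedSpace E X]
  {F : Type*} [NormedAddCommGroup F] [NormedSpace ℂ F]
  {A : Type*} [TopologicalSpace A] [ChartedSpace F A]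
  {φ : X → EReal} {hφ : UpperSemicontinuous φ}

/-- The first component of a holomorphic mapping into a Hartogs domain. -/
noncomputable def Hol.hartogsFst (f : Hol 𝓘(ℂ, F) (𝓘(ℂ, E).prod 𝓘(ℂ, ℂ)) A (hartogsDomain φ hφ)) :
    Hol 𝓘(ℂ, F) 𝓘(ℂ, E) A X :=
  ⟨⟨fun a => (f.1 a).1.1, by fun_prop⟩,
    mdifferentiable_fst.comp ((mdifferentiable_subtypeVal _).comp f.2)⟩

theorem Hol.mdifferentiable_hartogsSnd
    (f : Hol 𝓘(ℂ, F) (𝓘(ℂ, E).prod 𝓘(ℂ, ℂ)) A (hartogsDomain φ hφ)) :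
    MDifferentiable 𝓘(ℂ, F) 𝓘(ℂ, ℂ) fun a => (f.1 a).1.2 :=
  mdifferentiable_snd.comp ((mdifferentiable_subtypeVal _).comp f.2)

theorem convergenceSet_subset_hartogsFst
    (f : ℕ → Hol 𝓘(ℂ, F) (𝓘(ℂ, E).prod 𝓘(ℂ, ℂ)) A (hartogsDomain φ hφ)) :
    (convergenceSet fun k => ⇑(f k).1) ⊆ convergenceSet fun k => ⇑(f k).hartogsFst.1 :=
  fun _ ⟨p, hp⟩ => ⟨p.1.1, ((continuous_fst.comp continuous_subtype_val).tendsto p).comp hp⟩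

variable [CompleteSpace E] [T2Space X]
  [IsManifold 𝓘(ℂ, F) ω A] [ConnectedSpace A]

/-- A sequence of holomorphic mappings into the Hartogs domain of a continuous plurisubharmonic
function converges as soon as its projection to the base converges and its set of convergence
has a uniqueness point. -/
theorem convergesInHol_of_hartogsFst (hpsh : IsPSH E φ) (hφc : Continuous φ)
    (hbot : ∀ x, φ x ≠ ⊥) (htop : ∀ x, φ x ≠ ⊤)
    {f : ℕ → Hol 𝓘(ℂ, F) (𝓘(ℂ, E).prod 𝓘(ℂ, ℂ)) A (hartogsDomain φ hφ)}
    (hne : (uniquenessPoints F (convergenceSet fun k => ⇑(f k).1)).Nonempty)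
    (hfst : ConvergesInHol fun k => (f k).hartogsFst) : ConvergesInHol f := by
  obtain ⟨g, hg⟩ := hfst
  have : FirstCountableTopology A := ChartedSpace.firstCountableTopology F A
  have hgt : ∀ a, Tendsto (fun p : ℕ × A => ((f p.1).1 p.2).1.1) (atTop ×ˢ 𝓝 a) (𝓝 (g.1 a)) :=
    ContinuousMap.tendsto_uncurry_of_tendsto ((continuous_subtype_val.tendsto g).comp hg)
  let u : X → ℝ := fun x => (φ x).toReal
  have hφu : ∀ x, φ x = u x := fun x => (EReal.coe_toReal (htop x) (hbot x)).symm
  have hu : Continuous u := by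
    rw [← EReal.continuous_coe_iff]
    exact hφc.congr hφu
  have hmem : ∀ k a, ‖((f k).1 a).1.2‖ < Real.exp (-u ((f k).1 a).1.1) := fun k a =>
    (mem_hartogsDomain_iff_of_eq_coe hφu).1 ((f k).1 a).2
  have hexp : ∀ a, Tendsto (fun p : ℕ × A => Real.exp (-u ((f p.1).1 p.2).1.1)) (atTop ×ˢ 𝓝 a)
      (𝓝 (Real.exp (-u (g.1 a)))) := fun a =>
    ((Real.continuous_exp.comp hu.neg).tendsto _).comp (hgt a)
  obtain ⟨w, hw, hwt⟩ := exists_tendsto_uncurry_of_locally_bounded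
    (f := fun k a => ((f k).1 a).1.2) (S := convergenceSet fun k => ⇑(f k).1) (fun k => (f k).mdifferentiable_hartogsSnd)
    (fun a => ⟨Real.exp (-u (g.1 a)) + 1, by
      filter_upwards [(hexp a).eventually_lt_const (lt_add_one _)] with p hp
      exact ((hmem _ _).trans hp).le⟩)
    (fun _ ⟨p, hp⟩ => ⟨p.1.2, ((continuous_snd.comp continuous_subtype_val).tendsto p).comp hp⟩)
    hne
  have hle : ∀ a, ‖w a‖ ≤ Real.exp (-u (g.1 a)) := fun a =>
    le_of_tendsto_of_tendsto (hwt a).norm (hexp a) (.of_forall fun p => (hmem _ _).le)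
  -- A uniqueness point lies in the closure of the convergence set, so that set is nonempty. At `a₀`
  -- the limit lies in the open Hartogs domain, which gives the strict inequality the maximum
  -- principle starts from.
  obtain ⟨a₀, p₀, hp₀⟩ : (convergenceSet fun k => ⇑(f k).1).Nonempty := by
    obtain ⟨z, hz⟩ := hne
    exact closure_nonempty_iff.1 ⟨z, hz.1⟩
  have hdiag : Tendsto (fun k : ℕ => (k, a₀)) atTop (atTop ×ˢ 𝓝 a₀) :=
    tendsto_id.prodMk tendsto_const_nhds
  have h1 : p₀.1.1 = g.1 a₀ := tendsto_nhds_unique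
    (((continuous_fst.comp continuous_subtype_val).tendsto p₀).comp hp₀) ((hgt a₀).comp hdiag)
  have h2 : p₀.1.2 = w a₀ := tendsto_nhds_unique
    (((continuous_snd.comp continuous_subtype_val).tendsto p₀).comp hp₀) ((hwt a₀).comp hdiag)
  have hlt := norm_lt_exp_neg hpsh hu hφu g.2 hw hle (a₀ := a₀) (by
    rw [← h1, ← h2]
    exact (mem_hartogsDomain_iff_of_eq_coe hφu).1 p₀.2)
  let G : A → hartogsDomain φ hφ := fun a =>
    ⟨(g.1 a, w a), (mem_hartogsDomain_iff_of_eq_coe hφu).2 (hlt a)⟩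
  have hG : MDifferentiable 𝓘(ℂ, F) (𝓘(ℂ, E).prod 𝓘(ℂ, ℂ)) G :=
    (mdifferentiable_subtypeVal_comp_iff _ _).1 (g.2.prodMk hw)
  refine ⟨⟨⟨G, hG.continuous⟩, hG⟩, tendsto_subtype_rng.2 ?_⟩
  exact ContinuousMap.tendsto_of_tendsto_uncurry fun a =>
    tendsto_subtype_rng.2 ((hgt a).prodMk_nhds (hwt a))

end HartogsConvergence

/-! ### Consequences of the weak Vitali property of a Hartogs domain -/

section ZeroSection

variable {E : Type*} [NormedAddCommGroup E] [NormedSpace ℂ E]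
  {X : Type*} [TopologicalSpace X] [ChartedSpace E X]
  {F : Type*} [NormedAddCommGroup F] [NormedSpace ℂ F]
  {A : Type*} [TopologicalSpace A] [ChartedSpace F A]
  {φ : X → EReal}

theorem zero_mem_hartogsDomain (hφ : UpperSemicontinuous φ) {x : X} (hx : φ x ≠ ⊤) :
    ((x, 0) : X × ℂ) ∈ hartogsDomain φ hφ := by
  rw [mem_hartogsDomain, enorm_zero, ← EReal.exp_bot, EReal.exp_lt_exp_iff, bot_lt_iff_ne_bot,
    Ne, EReal.neg_eq_bot_iff]
  exact hx

/-- A holomorphic mapping into the base, as a mapping into the Hartogs domain. -/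
noncomputable def Hol.hartogsZero (hφ : UpperSemicontinuous φ) (htop : ∀ x, φ x ≠ ⊤)
    (f : Hol 𝓘(ℂ, F) 𝓘(ℂ, E) A X) :
    Hol 𝓘(ℂ, F) (𝓘(ℂ, E).prod 𝓘(ℂ, ℂ)) A (hartogsDomain φ hφ) :=
  ⟨⟨fun a => ⟨(f.1 a, 0), zero_mem_hartogsDomain hφ (htop _)⟩, by fun_prop⟩,
    (mdifferentiable_subtypeVal_comp_iff _ _).1 (f.2.prodMk mdifferentiable_const)⟩

theorem convergenceSet_subset_hartogsZero (hφ : UpperSemicontinuous φ) (htop : ∀ x, φ x ≠ ⊤)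
    (f : ℕ → Hol 𝓘(ℂ, F) 𝓘(ℂ, E) A X) :
    (convergenceSet fun k => ⇑(f k).1) ⊆
      convergenceSet fun k => ⇑((f k).hartogsZero hφ htop).1 :=
  fun _ ⟨x, hx⟩ => ⟨⟨(x, 0), zero_mem_hartogsDomain hφ (htop _)⟩,
    tendsto_subtype_rng.2 (hx.prodMk_nhds tendsto_const_nhds)⟩

theorem ConvergesInHol.of_hartogsZero {hφ : UpperSemicontinuous φ} {htop : ∀ x, φ x ≠ ⊤}
    {f : ℕ → Hol 𝓘(ℂ, F) 𝓘(ℂ, E) A X}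
    (h : ConvergesInHol fun k => (f k).hartogsZero hφ htop) : ConvergesInHol f := by
  obtain ⟨g, hg⟩ := h
  refine ⟨g.hartogsFst, tendsto_subtype_rng.2 ?_⟩
  let π : C(hartogsDomain φ hφ, X) := ⟨fun p => p.1.1, by fun_prop⟩
  exact ((π.continuous_postcomp.comp continuous_subtype_val).tendsto g).comp hg

end ZeroSection

/-! ### Testing the weak Vitali property on analytic discs -/

section Discs

variable {E : Type v} [NormedAddCommGroup E] [NormedSpace ℂ E]
  {X : Type u} [TopologicalSpace X] [ChartedSpace E X]
  {φ : X → EReal} {hφ : UpperSemicontinuous φ}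

/-- The weak Vitali property for sequences of analytic discs. -/
theorem HasWVP.exists_tendsto_of_disc
    (h : HasWVP.{u, v, v, w} (𝓘(ℂ, E).prod 𝓘(ℂ, ℂ)) (hartogsDomain φ hφ)) {c : ℂ} {r : ℝ}
    {G : ℕ → ℂ → X} {W : ℕ → ℂ → ℂ}
    (hG : ∀ k, MDifferentiableOn 𝓘(ℂ, ℂ) 𝓘(ℂ, E) (G k) (Metric.ball c r))
    (hW : ∀ k, DifferentiableOn ℂ (W k) (Metric.ball c r))
    (hmem : ∀ k, ∀ t ∈ Metric.ball c r, (G k t, W k t) ∈ hartogsDomain φ hφ)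
    {S : Set ℂ} (hS : S ⊆ Metric.ball c r) {z₀ : ℂ} (hz₀ : z₀ ∈ S)
    (hacc : ∃ᶠ t in 𝓝[≠] z₀, t ∈ S)
    (hconv : ∀ t ∈ S, ∃ p ∈ hartogsDomain φ hφ, Tendsto (fun k => (G k t, W k t)) atTop (𝓝 p))
    {t : ℂ} (ht : t ∈ Metric.ball c r) :
    ∃ p ∈ hartogsDomain φ hφ, Tendsto (fun k => (G k t, W k t)) atTop (𝓝 p) := by
  -- The disc is lifted to the universe over which the sources in `HasWVP` range.
  let D : TopologicalSpace.Opens (ULift.{w} ℂ) :=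
    ⟨ULift.down ⁻¹' Metric.ball c r, Metric.isOpen_ball.preimage continuous_uliftDown⟩
  let up : ℂ →L[ℂ] ULift.{w} ℂ := (ContinuousLinearEquiv.ulift (R₁ := ℂ) (M₁ := ℂ)).symm
  let down : ULift.{w} ℂ →L[ℂ] ℂ := (ContinuousLinearEquiv.ulift (R₁ := ℂ) (M₁ := ℂ))
  let ι : D → ℂ := fun a => a.1.down
  have hι : MDifferentiable 𝓘(ℂ, ULift.{w} ℂ) 𝓘(ℂ, ℂ) ι :=
    down.differentiable.mdifferentiable.comp (mdifferentiable_subtypeVal D)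
  let z : D := ⟨ULift.up z₀, hS hz₀⟩
  classical
  -- Inverse of `ι` on the disc; the value `z` outside is arbitrary.
  let j : ℂ → D := fun t => if ht : t ∈ Metric.ball c r then ⟨ULift.up t, ht⟩ else z
  have hjι : ∀ a, j (ι a) = a := fun a => dif_pos a.2
  have hιj : ∀ t ∈ Metric.ball c r, ι (j t) = t := fun t ht => by
    simp only [j, dif_pos ht, ι]
  have hj : MDifferentiableOn 𝓘(ℂ, ℂ) 𝓘(ℂ, ULift.{w} ℂ) j (Metric.ball c r) := fun t ht => by
    rw [← mdifferentiableWithinAt_subtypeVal_comp_iff]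
    refine (up.differentiable.mdifferentiable t).mdifferentiableWithinAt.congr (fun s hs => ?_) ?_
    · simp only [j, Function.comp_apply, dif_pos hs]; rfl
    · simp only [j, Function.comp_apply, dif_pos ht]; rfl
  have hconn : ConnectedSpace D := by
    refine isConnected_iff_connectedSpace.1 ?_
    have : ULift.down ⁻¹' Metric.ball c r = ULift.up '' Metric.ball c r := by
      ext x; exact ⟨fun hx => ⟨_, hx, rfl⟩, by rintro ⟨y, hy, rfl⟩; exact hy⟩
    change IsConnected (ULift.down ⁻¹' Metric.ball c r)
    rw [this]
    exact IsConnected.image ⟨⟨_, hS hz₀⟩, (convex_ball c r).isPreconnected⟩ _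
      continuous_uliftUp.continuousOn
  let f : ℕ → Hol 𝓘(ℂ, ULift.{w} ℂ) (𝓘(ℂ, E).prod 𝓘(ℂ, ℂ)) D (hartogsDomain φ hφ) := fun k =>
    have hf : MDifferentiable 𝓘(ℂ, ULift.{w} ℂ) (𝓘(ℂ, E).prod 𝓘(ℂ, ℂ))
        (fun a : D => (⟨(G k (ι a), W k (ι a)), hmem k _ a.2⟩ : hartogsDomain φ hφ)) := by
      refine (mdifferentiable_subtypeVal_comp_iff _ _).1 (MDifferentiable.prodMk ?_ ?_)
      · exact fun a => ((hG k).mdifferentiableAt (Metric.isOpen_ball.mem_nhds a.2)).comp a (hι a)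
      · exact fun a => ((hW k).mdifferentiableOn.mdifferentiableAt
          (Metric.isOpen_ball.mem_nhds a.2)).comp a (hι a)
    ⟨⟨_, hf.continuous⟩, hf⟩
  have hSZ : ∀ s ∈ S, j s ∈ convergenceSet fun k => ⇑(f k).1 := fun s hs => by
    obtain ⟨p, hp, hlim⟩ := hconv s hs
    refine ⟨⟨p, hp⟩, tendsto_subtype_rng.2 ?_⟩
    simpa only [f, ContinuousMap.coe_mk, hιj s (hS hs)] using hlim
  have hjz : j z₀ = z := dif_pos (hS hz₀)
  have hz : z ∈ convergenceSet fun k => ⇑(f k).1 := hjz ▸ hSZ _ hz₀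
  -- The point `z₀` is an accumulation point of `S`, so this is the one-variable identity theorem on
  -- the planar image of `U`.
  have huniq : z ∈ uniquenessPoints (ULift.{w} ℂ) (convergenceSet fun k => ⇑(f k).1) := by
    refine ⟨subset_closure hz, fun U hU hUc hzU g hg hg0 x hx => ?_⟩
    have hV : IsOpen (Metric.ball c r ∩ j ⁻¹' U) :=
      hj.continuousOn.isOpen_inter_preimage Metric.isOpen_ball hU
    have hVeq : Metric.ball c r ∩ j ⁻¹' U = ι '' U := by
      ext s
      constructor
      · exact fun hs => ⟨j s, hs.2, hιj s hs.1⟩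
      · rintro ⟨a, ha, rfl⟩
        exact ⟨a.2, by rwa [mem_preimage, hjι]⟩
    have hVc : IsPreconnected (Metric.ball c r ∩ j ⁻¹' U) :=
      hVeq ▸ hUc.isPreconnected.image _ hι.continuous.continuousOn
    have hgj : DifferentiableOn ℂ (g ∘ j) (Metric.ball c r ∩ j ⁻¹' U) :=
      mdifferentiableOn_iff_differentiableOn.1 <|
        hg.comp (hj.mono inter_subset_left) fun s hs => hs.2
    have hz₀V : z₀ ∈ Metric.ball c r ∩ j ⁻¹' U := ⟨hS hz₀, by rwa [mem_preimage, hjz]⟩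
    have hfreq : ∃ᶠ s in 𝓝[≠] z₀, (g ∘ j) s = 0 := by
      refine (hacc.and_eventually
        (mem_nhdsWithin_of_mem_nhds (hV.mem_nhds hz₀V))).mono fun s hs => ?_
      exact hg0 _ ⟨hs.2.2, hSZ s hs.1⟩
    have := (hgj.analyticOnNhd hV).eqOn_zero_of_preconnected_of_frequently_eq_zero hVc hz₀V hfreq
      (show ι x ∈ _ from hVeq ▸ mem_image_of_mem ι hx)
    simpa only [Function.comp_apply, hjι, Pi.zero_apply] using this
  obtain ⟨g, hg⟩ := h (ULift.{w} ℂ) D f ⟨z, hz, huniq⟩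
  refine ⟨(g.1 (j t)).1, (g.1 (j t)).2, ?_⟩
  have := (((continuous_subtype_val.comp (continuous_eval_const (j t))).comp
    continuous_subtype_val).tendsto g).comp hg
  simpa only [f, Function.comp_def, ContinuousMap.coe_mk, hιj t ht] using this

/-- If `φ x = ⊥`, the full line over `x` lies in the domain and imposes no bound on the second
component, so Vitali convergence fails there for unbounded sequences. -/
theorem HasWVP.ne_bot
    (h : HasWVP.{u, v, v, w} (𝓘(ℂ, E).prod 𝓘(ℂ, ℂ)) (hartogsDomain φ hφ)) (x : X) :
    φ x ≠ ⊥ := by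
  intro hx
  have hall : ∀ z : ℂ, (x, z) ∈ hartogsDomain φ hφ := fun z => by
    rw [mem_hartogsDomain, hx, EReal.neg_bot, EReal.exp_top]
    exact enorm_lt_top
  -- Polynomials vanishing at `0` and at `1 / (n + 1)` for `n < k`, normalised so that `W k 2 = k`.
  -- At each point of `{0} ∪ {1 / (n + 1)}` they are eventually zero, yet they diverge at `2`.
  let W : ℕ → ℂ → ℂ := fun k t => k * (t / 2) *
    ∏ n ∈ Finset.range k, (t - 1 / ((n : ℂ) + 1)) / (2 - 1 / ((n : ℂ) + 1))
  let s : ℕ → ℂ := fun n => 1 / ((n : ℂ) + 1)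
  have hs0 : Tendsto s atTop (𝓝 0) := tendsto_one_div_add_atTop_nhds_zero_nat
  have hsne : ∀ n, s n ≠ 0 := fun n => one_div_ne_zero (Nat.cast_add_one_ne_zero n)
  have hsn : ∀ n, ‖s n‖ ≤ 1 := fun n => by
    have : ‖(n : ℂ) + 1‖ = n + 1 := by exact_mod_cast Complex.norm_natCast (n + 1)
    rw [norm_div, norm_one, this]
    exact (div_le_one (by positivity)).2 (by simp)
  obtain ⟨p, -, hp⟩ := h.exists_tendsto_of_disc (c := 0) (r := 3) (G := fun _ _ => x) (W := W)
    (S := insert 0 (range s)) (z₀ := 0) (t := 2) (fun _ => mdifferentiableOn_const)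
    (fun k => by
      refine Differentiable.differentiableOn ?_
      simp only [W]
      fun_prop)
    (fun _ _ _ => hall _)
    (by
      rintro _ (rfl | ⟨n, rfl⟩)
      · simp
      · exact mem_ball_zero_iff.2 ((hsn n).trans_lt (by norm_num)))
    (mem_insert _ _)
    (by
      have : Tendsto s atTop (𝓝[≠] 0) :=
        tendsto_nhdsWithin_iff.2 ⟨hs0, .of_forall hsne⟩
      exact this.frequently (Frequently.of_forall fun n => Or.inr ⟨n, rfl⟩))
    (by
      intro t ht
      refine ⟨(x, 0), hall 0, tendsto_const_nhds.prodMk_nhds ?_⟩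
      rcases ht with rfl | ⟨n, rfl⟩
      · simp [W]
      · refine tendsto_const_nhds.congr' ?_
        filter_upwards [eventually_gt_atTop n] with k hk
        rw [eq_comm, mul_eq_zero]
        exact Or.inr (Finset.prod_eq_zero (Finset.mem_range.2 hk) (by simp [s])))
    (mem_ball_zero_iff.2 (by norm_num))
  have h2 : ∀ k, W k 2 = k := fun k => by
    have : ∀ n : ℕ, (2 - 1 / ((n : ℂ) + 1)) ≠ 0 := fun n h0 => by
      have h1 : ‖1 / ((n : ℂ) + 1)‖ ≤ 1 := hsn n
      rw [← sub_eq_zero.1 h0] at h1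
      norm_num at h1
    simp only [W]
    rw [Finset.prod_eq_one fun n _ => div_self (this n)]
    norm_num
  have h3 : Tendsto (fun k : ℕ => ‖W k 2‖) atTop (𝓝 ‖p.2‖) :=
    ((continuous_snd.tendsto p).comp hp).norm
  simp only [h2, Complex.norm_natCast] at h3
  exact not_tendsto_nhds_of_tendsto_atTop tendsto_natCast_atTop_atTop _ h3

/-- Otherwise some `s k → x` have fibres containing the disc of a fixed radius `e^{-c}`, larger than
the fibre radius `e^{-b}` over `x`. These vertical discs converge in the domain near their centres,
but their limit leaves it. -/
theorem HasWVP.lowerSemicontinuous [T2Space X] (htop : ∀ x, φ x ≠ ⊤)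
    (h : HasWVP.{u, v, v, w} (𝓘(ℂ, E).prod 𝓘(ℂ, ℂ)) (hartogsDomain φ hφ)) :
    LowerSemicontinuous φ := by
  intro x y hy
  have : FirstCountableTopology X := ChartedSpace.firstCountableTopology E X
  by_contra hne
  obtain ⟨b, hb⟩ : ∃ b : ℝ, φ x = b := ⟨_, (EReal.coe_toReal (htop x) (h.ne_bot x)).symm⟩
  obtain ⟨c, hyc, hcx⟩ := EReal.lt_iff_exists_real_btwn.1 hy
  obtain ⟨s, hs, hsy⟩ := exists_seq_forall_of_frequently (not_eventually.1 hne)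
  have hcb : c < b := by rwa [hb, EReal.coe_lt_coe_iff] at hcx
  have hexp : ∀ t : ℂ, ‖(Real.exp (-c) : ℂ) * t‖ = Real.exp (-c) * ‖t‖ := fun t => by
    rw [norm_mul, Complex.norm_real, Real.norm_of_nonneg (Real.exp_pos _).le]
  have hx : ∀ z : ℂ, (x, z) ∈ hartogsDomain φ hφ ↔ ‖z‖ < Real.exp (-b) := fun z => by
    rw [mem_hartogsDomain, hb, enorm_lt_exp_neg_coe]
  let S : Set ℂ := {t | t ∈ Metric.ball 0 1 ∧ ‖(Real.exp (-c) : ℂ) * t‖ < Real.exp (-b)}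
  have hS : IsOpen S := Metric.isOpen_ball.inter
    (isOpen_lt (continuous_const.mul continuous_id).norm continuous_const)
  have hS0 : (0 : ℂ) ∈ S := ⟨by simp, by simpa using Real.exp_pos _⟩
  -- The parameter `t = e^{c - b}` is chosen so that the limit point has `‖e^{-c} t‖ = e^{-b}`,
  -- exactly on the boundary of the fibre.
  obtain ⟨p, hp, hlim⟩ := h.exists_tendsto_of_disc (c := 0) (r := 1) (G := fun k _ => s k)
    (W := fun _ t => (Real.exp (-c) : ℂ) * t) (S := S) (z₀ := 0) (t := (Real.exp (c - b) : ℂ))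
    (fun _ => mdifferentiableOn_const) (fun _ => by fun_prop)
    (fun k t ht => by
      have h1 : ‖(Real.exp (-c) : ℂ) * t‖ < Real.exp (-c) := by
        rw [hexp]
        exact mul_lt_of_lt_one_right (Real.exp_pos _) (mem_ball_zero_iff.1 ht)
      refine (enorm_lt_exp_neg_coe.2 h1).trans_le (EReal.exp_monotone ?_)
      exact EReal.neg_le_neg_iff.2 ((not_lt.1 (hsy k)).trans hyc.le))
    (fun t ht => ht.1) hS0
    (Eventually.frequently (mem_nhdsWithin_of_mem_nhds (hS.mem_nhds hS0)))
    (fun t ht => ⟨(x, _), (hx _).2 ht.2, hs.prodMk_nhds tendsto_const_nhds⟩)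
    (by
      rw [mem_ball_zero_iff, Complex.norm_real, Real.norm_of_nonneg (Real.exp_pos _).le]
      rw [← Real.exp_zero, Real.exp_lt_exp]
      linarith)
  rw [tendsto_nhds_unique hlim (hs.prodMk_nhds tendsto_const_nhds), hx, hexp, Complex.norm_real,
    Real.norm_of_nonneg (Real.exp_pos _).le, ← Real.exp_add] at hp
  exact hp.ne (by congr 1; ring)

/-- If the inequality fails, some `Re q` dominates `u ∘ γ` on the circle but not at the centre, so
`v = u ∘ γ - Re q` has a positive interior maximum. The graphs of `exp (-a - q)` over `γ` lie in the
domain exactly where `v < a`; letting `a` decrease to the maximum makes the limit touch the boundary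
at an interior point. -/
theorem HasWVP.le_circleAverage [T2Space X]
    (h : HasWVP.{u, v, v, w} (𝓘(ℂ, E).prod 𝓘(ℂ, ℂ)) (hartogsDomain φ hφ)) {u : X → ℝ}
    (hu : Continuous u) (hφu : ∀ x, φ x = u x) {γ : ℂ → X} {c : ℂ} {r : ℝ} (hr : 0 < r)
    (hγ : MDifferentiableOn 𝓘(ℂ, ℂ) 𝓘(ℂ, E) γ (Metric.ball c r))
    (hγc : ContinuousOn γ (Metric.closedBall c r)) :
    u (γ c) ≤ Real.circleAverage (fun t => u (γ t)) c r := by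
  by_contra! hlt
  have huc : ContinuousOn (fun t => u (γ t)) (Metric.closedBall c r) := hu.comp_continuousOn hγc
  obtain ⟨q, hq, hcen, ε, hε, hsph⟩ := exists_differentiable_re_gt_of_circleAverage_lt
    (u := fun t => u (γ t)) hr (huc.mono Metric.sphere_subset_closedBall) hlt
  have hqc := hq.continuous
  let v : ℂ → ℝ := fun t => u (γ t) - (q t).re
  have hv : ContinuousOn v (Metric.closedBall c r) := huc.sub (by fun_prop)
  obtain ⟨z, hz, hmax⟩ := (isCompact_closedBall c r).exists_isMaxOn
    ⟨c, Metric.mem_closedBall_self hr.le⟩ hv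
  have hvz : 0 < v z :=
    (sub_pos.2 hcen).trans_le (hmax (Metric.mem_closedBall_self hr.le))
  have hzb : z ∈ Metric.ball c r := by
    rcases (Metric.mem_closedBall.1 hz).lt_or_eq with h1 | h1
    · exact h1
    · exact absurd ((hsph z h1).trans (neg_neg_of_pos hε)) (not_lt.2 hvz.le)
  let S : Set ℂ := Metric.ball c r ∩ v ⁻¹' Iio 0
  have hS : IsOpen S := (hv.mono Metric.ball_subset_closedBall).isOpen_inter_preimage
    Metric.isOpen_ball isOpen_Iio
  -- Since `v` is negative on the circle, it is negative at nearby points of the open disc. There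
  -- the limit graph lies inside the domain.
  obtain ⟨z₀, hz₀⟩ : S.Nonempty := by
    obtain ⟨y, hy⟩ : (Metric.sphere c r).Nonempty := NormedSpace.sphere_nonempty.2 hr.le
    have hyc := Metric.sphere_subset_closedBall hy
    have hcl : y ∈ closure (Metric.ball c r) := by rwa [closure_ball c hr.ne']
    have := mem_closure_iff_nhdsWithin_neBot.1 hcl
    have h1 : ∀ᶠ t in 𝓝[Metric.ball c r] y, v t < 0 :=
      ((hv y hyc).mono Metric.ball_subset_closedBall).eventually_lt_const
        ((hsph y hy).trans (neg_neg_of_pos hε))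
    obtain ⟨t, ht, htb⟩ := (h1.and self_mem_nhdsWithin).exists
    exact ⟨t, htb, ht⟩
  have hnorm : ∀ (a : ℝ) t, ‖Complex.exp (-(a : ℂ) - q t)‖ = Real.exp (-a - (q t).re) :=
    fun a t => by simp [Complex.norm_exp]
  have hmem : ∀ (a : ℝ) t,
      (γ t, Complex.exp (-(a : ℂ) - q t)) ∈ hartogsDomain φ hφ ↔ v t < a := fun a t => by
    rw [mem_hartogsDomain_iff_of_eq_coe hφu, hnorm, Real.exp_lt_exp]
    simp only [v]
    constructor <;> intro _ <;> linarith
  let a : ℕ → ℝ := fun k => v z + 1 / ((k : ℝ) + 1)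
  have ha : Tendsto a atTop (𝓝 (v z)) := by
    simpa [a] using (tendsto_one_div_add_atTop_nhds_zero_nat (𝕜 := ℝ)).const_add (v z)
  have hlim : ∀ t, Tendsto (fun k => (γ t, Complex.exp (-(a k : ℂ) - q t))) atTop
      (𝓝 (γ t, Complex.exp (-(v z : ℂ) - q t))) := fun t => by
    have h1 : Continuous fun b : ℝ => (γ t, Complex.exp (-(b : ℂ) - q t)) := by fun_prop
    exact (h1.tendsto (v z)).comp ha
  obtain ⟨p, hp, hpl⟩ := h.exists_tendsto_of_disc (c := c) (r := r) (G := fun _ => γ)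
    (W := fun k t => Complex.exp (-(a k : ℂ) - q t)) (S := S) (z₀ := z₀) (t := z)
    (fun _ => hγ) (fun _ => by fun_prop)
    (fun k t ht => (hmem _ _).2 ((hmax (Metric.ball_subset_closedBall ht)).trans_lt
      (lt_add_of_pos_right _ (by positivity))))
    inter_subset_left hz₀ (Eventually.frequently (mem_nhdsWithin_of_mem_nhds (hS.mem_nhds hz₀)))
    (fun t ht => ⟨_, (hmem (v z) t).2 (lt_trans ht.2 hvz), hlim t⟩) hzb
  rw [tendsto_nhds_unique hpl (hlim z), hmem] at hp
  exact lt_irrefl _ hp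

theorem HasWVP.isPSH [T2Space X] [IsManifold 𝓘(ℂ, E) ω X]
    (h : HasWVP.{u, v, v, w} (𝓘(ℂ, E).prod 𝓘(ℂ, ℂ)) (hartogsDomain φ hφ)) (hφc : Continuous φ)
    (htop : ∀ x, φ x ≠ ⊤) : IsPSH E φ := by
  intro x
  let u : X → ℝ := fun x => (φ x).toReal
  have hφu : ∀ x, φ x = u x := fun x => (EReal.coe_toReal (htop x) (h.ne_bot x)).symm
  have hu : Continuous u := by
    rw [← EReal.continuous_coe_iff]
    exact hφc.congr hφu
  obtain ⟨r, hr, hrt, -⟩ := exists_ball_chartAt (F := E) (a := x) univ_mem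
  set κ := chartAt E x
  have hκ : κ ∈ IsManifold.maximalAtlas 𝓘(ℂ, E) ω X := IsManifold.chart_mem_maximalAtlas x
  have hopen : IsOpen (κ.source ∩ κ ⁻¹' Metric.ball (κ x) r) :=
    κ.isOpen_inter_preimage Metric.isOpen_ball
  have hsymm : ContinuousOn κ.symm (Metric.ball (κ x) r) := κ.continuousOn_symm.mono hrt
  -- The preferred chart is cut down so that its image is a ball. Complex lines in that ball are
  -- analytic discs in `X`, to which `HasWVP.le_circleAverage` applies.
  refine ⟨κ.restr (κ.source ∩ κ ⁻¹' Metric.ball (κ x) r),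
    restr_mem_maximalAtlas _ hκ hopen, ?_, κ x, r, ?_, fun _ _ => htop _, ?_, fun a b => ?_⟩
  · rw [κ.restr_source' _ hopen]
    exact ⟨mem_chart_source E x, mem_chart_source E x, Metric.mem_ball_self hr⟩
  · ext y
    simp only [OpenPartialHomeomorph.restr_toPartialEquiv, PartialEquiv.restr_target,
      hopen.interior_eq, mem_inter_iff, mem_preimage]
    constructor
    · rintro ⟨hy, -, hy'⟩
      simpa [κ.right_inv hy] using hy'
    · intro hy
      refine ⟨hrt hy, κ.map_target (hrt hy), ?_⟩
      simpa [κ.right_inv (hrt hy)] using hy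
  · exact (hφc.comp_continuousOn hsymm).upperSemicontinuousOn
  · have hline : ContinuousOn (fun t : ℂ => κ.symm (a + t • b))
        {t | a + t • b ∈ Metric.ball (κ x) r} := hsymm.comp (by fun_prop) fun t ht => ht
    refine ⟨fun _ _ => htop _, (hφc.comp_continuousOn hline).upperSemicontinuousOn,
      fun c s hs hcs => ?_⟩
    have hγ : MDifferentiableOn 𝓘(ℂ, ℂ) 𝓘(ℂ, E) (fun t : ℂ => κ.symm (a + t • b))
        (Metric.ball c s) := by
      have hℓ : DifferentiableOn ℂ (fun t : ℂ => a + t • b) (Metric.ball c s) := by fun_prop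
      exact (mdifferentiableOn_symm_of_mem_maximalAtlas_omega hκ).comp hℓ.mdifferentiableOn
        fun t ht => hrt (hcs (Metric.ball_subset_closedBall ht))
    have hc := hline.mono hcs
    have key := h.le_circleAverage hu hφu hs hγ hc
    change φ (κ.symm (a + c • b)) ≤ circleMean (fun t => φ (κ.symm (a + t • b))) c s
    rw [circleMean_eq_circleAverage hs.le (fun t _ => hφu _)
      (hu.comp_continuousOn (hc.mono Metric.sphere_subset_closedBall)), hφu]
    exact EReal.coe_le_coe_iff.2 key

end Discs

/-! ### The equivalences for both Vitali properties -/

theorem HasSVP.hasWVP {E : Type v} [NormedAddCommGroup E] [NormedSpace ℂ E]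
    {H : Type v'} [TopologicalSpace H] {I : ModelWithCorners ℂ E H}
    {X : Type u} [TopologicalSpace X] [ChartedSpace H X] (h : HasSVP.{u, v, v', w} I X) :
    HasWVP.{u, v, v', w} I X := fun F _ _ _ A _ _ _ _ _ f hf =>
  h F A f (hf.mono inter_subset_right)

theorem proposition4p5
    {E : Type v} [NormedAddCommGroup E] [NormedSpace ℂ E] [CompleteSpace E]
    {X : Type u} [TopologicalSpace X] [ChartedSpace E X] [IsManifold 𝓘(ℂ, E) ω X]
    [T2Space X] [ConnectedSpace X]
    (φ : X → EReal) (hφtop : ∀ x, φ x ≠ ⊤) (hφ : UpperSemicontinuous φ) :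
    (HasSVP.{u, v, v, w} (𝓘(ℂ, E).prod 𝓘(ℂ, ℂ)) (hartogsDomain φ hφ) ↔
      ((∀ x, φ x ≠ ⊥) ∧ Continuous φ ∧ IsPSH E φ) ∧ HasSVP.{u, v, v, w} 𝓘(ℂ, E) X) ∧
    (HasWVP.{u, v, v, w} (𝓘(ℂ, E).prod 𝓘(ℂ, ℂ)) (hartogsDomain φ hφ) ↔
      ((∀ x, φ x ≠ ⊥) ∧ Continuous φ ∧ IsPSH E φ) ∧ HasWVP.{u, v, v, w} 𝓘(ℂ, E) X) := by
  have hprop : HasWVP.{u, v, v, w} (𝓘(ℂ, E).prod 𝓘(ℂ, ℂ)) (hartogsDomain φ hφ) →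
      (∀ x, φ x ≠ ⊥) ∧ Continuous φ ∧ IsPSH E φ := fun h =>
    have hc : Continuous φ :=
      continuous_iff_lower_upperSemicontinuous.2 ⟨h.lowerSemicontinuous hφtop, hφ⟩
    ⟨h.ne_bot, hc, h.isPSH hc hφtop⟩
  refine ⟨⟨fun h => ⟨hprop h.hasWVP, ?_⟩, fun ⟨⟨hbot, hc, hpsh⟩, h⟩ => ?_⟩,
    ⟨fun h => ⟨hprop h, ?_⟩, fun ⟨⟨hbot, hc, hpsh⟩, h⟩ => ?_⟩⟩
  · intro F _ _ _ A _ _ _ _ _ f hf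
    exact (h F A (fun k => (f k).hartogsZero hφ hφtop)
      (hf.mono (uniquenessPoints_mono (convergenceSet_subset_hartogsZero hφ hφtop f)))).of_hartogsZero
  · intro F _ _ _ A _ _ _ _ _ f hf
    exact convergesInHol_of_hartogsFst hpsh hc hbot hφtop hf (h F A (fun k => (f k).hartogsFst)
      (hf.mono (uniquenessPoints_mono (convergenceSet_subset_hartogsFst f))))
  · intro F _ _ _ A _ _ _ _ _ f hf
    have hsub := convergenceSet_subset_hartogsZero hφ hφtop f
    exact (h F A (fun k => (f k).hartogsZero hφ hφtop)
      (hf.mono (inter_subset_inter hsub (uniquenessPoints_mono hsub)))).of_hartogsZero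
  · intro F _ _ _ A _ _ _ _ _ f hf
    have hsub := convergenceSet_subset_hartogsFst f
    exact convergesInHol_of_hartogsFst hpsh hc hbot hφtop (hf.mono inter_subset_right)
      (h F A (fun k => (f k).hartogsFst)
        (hf.mono (inter_subset_inter hsub (uniquenessPoints_mono hsub))))
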